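/- **Setting.** There are $K$ topics, a vocabulary of $M$ terms, and $D$ documents of $N\ge 1$ words $w_{dn}$ each, with responses $y_d\in\mathbb R$. Let $p_0$ be a probability distribution (the prior) of $\eta\in\mathbb R^K$, let $\alpha\in(0,\infty)^K$, let $\beta$ be a $K\times M$ matrix whose rows are probability distributions, and let $\delta^2>0$, $C>0$, $\epsilon\in\mathbb R$. In the Bayesian sLDA model, $\eta\sim p_0$, $\theta_d\sim \mathrm{Dir}(\alpha)$, the topic assignments satisfy $z_{dn}\mid\theta_d\sim\mathrm{Mult}(\theta_d)$, the words satisfy $w_{dn}\mid z_{dn}\sim\mathrm{Mult}(\beta_{z_{dn}})$, and $y_d\mid z,\eta\sim N(\eta^\top\bar Z_d,\delta^2)$, where $\bar Z_d=\frac1N\sum_n Z_{dn}$ and $Z_{dn}\in\{0,1\}^K$ is the indicator vector of $z_{dn}$. Let $p(\theta,z,\eta,y,W)$ be the joint density. Fix the variational parameters: $\gamma_d\in(0,\infty)^K$ and probability vectors $\phi_{dn}\in\mathbb R^K$ with $\beta_{k,w_{dn}}>0$ whenever $\phi_{dnk}>0$. For a probability distribution $q(\eta)$ on $\mathbb R^K$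 put $q(\theta,z,\eta)=q(\eta)\prod_d \mathrm{Dir}(\theta_d\mid\gamma_d)\prod_{n}q(z_{dn}\mid\phi_{dn})$, let $E$ be the expectation under it, and let $\mathcal L^{bs}(q)=E[\log q(\theta,z,\eta)-\log p(\theta,z,\eta,y,W)]\in(-\infty,\infty]$. The problem P1 with these quantities held fixed is to minimize $\mathcal L^{bs}(q)+C\sum_d(\xi_d+\xi_d^\star)$ over $q(\eta)$ (for which the expectations $E[\eta^\top\bar Z_d]$ exist) and $\xi,\xi^\star\in\mathbb R^D$, subject to, for all $d$, $$y_d-E[\eta^\top\bar Z_d]\le\epsilon+\xi_d,\qquad -y_d+E[\eta^\top\bar Z_d]\le\epsilon+\xi_d^\star,\qquad \xi_d\ge0,\qquad \xi_d^\star\ge 0,$$ with respective Lagrange multipliers $\mu_d,\mu_d^\star,v_d,v_d^\star\ge0$, that is, nonnegative numbers for which the infimum of the Lagrangian $L$ over $(q(\eta),\xi,\xi^\star)$ equals the optimal value of P1. Let $A$ be the $D\times K$ matrix with rows $\bar Z_d^\top$. **Theorem.** One has $E[\bar Z_d]=\frac1N\sum_n\phi_{dn}$, $E[A^\top A]=\sum_d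 E[\bar Z_d\bar Z_d^\top]$ and $$E[\bar Z_d\bar Z_d^\top]=\frac1{N^2}\Big(\sum_{n}\sum_{m\ne n}\phi_{dn}\phi_{dm}^\top+\sum_n\mathrm{diag}\{\phi_{dn}\}\Big).$$ For all $\mu,\mu^\star\in\mathbb R^D$ the normalization constant $$Z(\mu,\mu^\star)=\int \exp\Big(\eta^\top\sum_{d}\big(\mu_d-\mu_d^\star+\tfrac{y_d}{\delta^2}\big)E[\bar Z_d]-\eta^\top\tfrac{E[A^\top A]}{2\delta^2}\eta\Big)\,p_0(d\eta)$$ is finite and positive. Consider $$\text{D1:}\qquad\max_{\mu,\mu^\star}\ -\log Z(\mu,\mu^\star)-\epsilon\sum_d(\mu_d+\mu_d^\star)+\sum_d y_d(\mu_d-\mu_d^\star)\quad\text{s.t. } \mu_d,\mu_d^\star\in[0,C]\ \ \forall d .$$ 1. D1 is the Lagrange dual of P1: up to an additive constant independent of the multipliers, $\inf_{q,\xi,\xi^\star}L$ is the objective of D1 if $v_d=C-\mu_d$ and $v_d^\star=C-\mu_d^\star$ for all $d$, and it is $-\infty$ otherwise. 2. D1 has a solution, and $(\mu,\mu^\star,v,v^\star)$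 are Lagrange multipliers of P1 if and only if $(\mu,\mu^\star)$ solves D1 and $v_d=C-\mu_d$, $v_d^\star=C-\mu_d^\star$ for all $d$. 3. For every solution $(\mu,\mu^\star)$ of D1, P1 has an optimal solution whose $q(\eta)$ is $$q(\eta)=\frac{p_0(\eta)}{Z(\mu,\mu^\star)}\exp\Big(\eta^\top\sum_{d}\big(\mu_d-\mu_d^\star+\tfrac{y_d}{\delta^2}\big)E[\bar Z_d]-\eta^\top\tfrac{E[A^\top A]}{2\delta^2}\eta\Big),$$ and every optimal solution of P1 has this $q(\eta)$. -/

import Mathlib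

open MeasureTheory ProbabilityTheory Matrix
open scoped NNReal ENNReal

noncomputable section

/-- The Dirichlet distribution `Dir(a)`: the law of `(g_k / ∑_j g_j)_k` for independent
`g_k ∼ Gamma(a_k, 1)` (all `a_k > 0`). -/
def dirichletMeasure {K : ℕ} (a : Fin K → ℝ) : Measure (Fin K → ℝ) :=
  (Measure.pi fun k => gammaMeasure (a k) 1).map fun g k => g k / ∑ j, g j

/-- The categorical distribution with weights `p`. -/
def categoricalMeasure {K : ℕ} (p : Fin K → ℝ) : Measure (Fin K) :=
  ∑ k, ENNReal.ofReal (p k) • Measure.dirac k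

/-- `E_Q[log (Q / P)] = -E_Q[log P] - H(Q)`, the (unnormalized) relative entropy. `P` may be any
finite measure; then the negative part of the integrand is always `Q`-integrable, so that the value
is a real number or `+∞`. -/
def expectedLogRatio {X : Type*} [MeasurableSpace X] (Q P : Measure X) : EReal :=
  open Classical in
  if Q ≪ P ∧ Integrable (llr Q P) Q then ((∫ x, llr Q P x ∂Q : ℝ) : EReal) else ⊤

/-- Topic assignments of all words of all documents. -/
abbrev Assignment (K D N : ℕ) : Type := Fin D → Fin N → Fin K

/-- Values `(η, θ, z)` of the latent variables. -/
abbrev Latent (K D N : ℕ) : Type :=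
  (Fin K → ℝ) × (Fin D → Fin K → ℝ) × Assignment K D N

/-- `Z̄_d = (1/N) ∑_n Z_dn`, where the topic assignment `Z_dn` is viewed as an indicator vector. -/
def zbar {K D N : ℕ} (z : Assignment K D N) (d : Fin D) : Fin K → ℝ :=
  (1 / (N : ℝ)) • ∑ n, Pi.single (z d n) (1 : ℝ)

/-- The `D × K` matrix `A` whose rows are the vectors `Z̄_dᵀ`. -/
def topicMatrix {K D N : ℕ} (z : Assignment K D N) : Matrix (Fin D) (Fin K) ℝ :=
  Matrix.of fun d => zbar z d

/-- The data of the regression problem with `K` topics, `D` documents of `N` words each, over a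
vocabulary of `M` terms, together with the quantities that are held fixed while `q(η)` is
optimized. -/
structure MedLDA (K D N M : ℕ) where
  /-- the words `W` -/
  w : Fin D → Fin N → Fin M
  /-- the responses -/
  y : Fin D → ℝ
  /-- the regularization constant -/
  C : ℝ
  /-- the precision of the insensitive loss -/
  ε : ℝ
  /-- the prior of `η` -/
  p₀ : Measure (Fin K → ℝ)
  /-- the Dirichlet parameter of the model -/
  α : Fin K → ℝ
  /-- the topics, row `k` being a distribution over terms -/
  β : Matrix (Fin K) (Fin M) ℝ
  /-- the variance `δ²` of the response -/
  δsq : ℝ≥0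
  /-- the variational Dirichlet parameters -/
  γ : Fin D → Fin K → ℝ
  /-- the variational categorical parameters -/
  φ : Fin D → Fin N → Fin K → ℝ

namespace MedLDA

variable {K D N M : ℕ} (m : MedLDA K D N M)

/-- The joint `p(θ, z, η, y, W | α, β, δ²)` at the observed `y` and `W`, as a measure in the latent
variables `(η, θ, z)`. -/
def joint : Measure (Latent K D N) :=
  (m.p₀.prod ((Measure.pi fun _ => dirichletMeasure m.α).prod Measure.count)).withDensity
    fun x => ENNReal.ofReal (∏ d,
      ((∏ n, x.2.1 d (x.2.2 d n) * m.β (x.2.2 d n) (m.w d n)) *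
        gaussianPDFReal (x.1 ⬝ᵥ zbar x.2.2 d) m.δsq (m.y d)))

/-- The factor `∏_d ∏_n q(z_dn | φ_dn)` of the variational distribution. -/
def qz : Measure (Assignment K D N) :=
  Measure.pi fun d => Measure.pi fun n => categoricalMeasure (m.φ d n)

/-- The variational distribution `q(θ, z, η) = q(η) ∏_d q(θ_d | γ_d) ∏_n q(z_dn | φ_dn)`. -/
def variational (q : Measure (Fin K → ℝ)) : Measure (Latent K D N) :=
  q.prod ((Measure.pi fun d => dirichletMeasure (m.γ d)).prod m.qz)

/-- The variational bound `L^bs(q) = -E_q[log p(θ, z, η, y, W | α, β, δ²)] - H(q(θ, z, η))`. -/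
def Lbs (q : Measure (Fin K → ℝ)) : EReal :=
  expectedLogRatio (m.variational q) m.joint

/-- `E[ηᵀ Z̄_d]` under the variational distribution. -/
def Emargin (q : Measure (Fin K → ℝ)) (d : Fin D) : ℝ :=
  ∫ x, x.1 ⬝ᵥ zbar x.2.2 d ∂(m.variational q)

/-- `q` is a probability distribution for which the expectations `E[ηᵀ Z̄_d]` exist. -/
structure Admissible (q : Measure (Fin K → ℝ)) : Prop where
  prob : IsProbabilityMeasure q
  integrable : ∀ d, Integrable (fun x : Latent K D N => x.1 ⬝ᵥ zbar x.2.2 d) (m.variational q)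

/-- The constraints of the primal problem. -/
structure Feasible (q : Measure (Fin K → ℝ)) (ξ ξs : Fin D → ℝ) : Prop where
  admissible : m.Admissible q
  upper : ∀ d, m.y d - m.Emargin q d ≤ m.ε + ξ d
  lower : ∀ d, -m.y d + m.Emargin q d ≤ m.ε + ξs d
  slack_nonneg : ∀ d, 0 ≤ ξ d
  slacks_nonneg : ∀ d, 0 ≤ ξs d

/-- The primal objective `L^bs(q) + C ∑_d (ξ_d + ξ_d*)`. -/
def objective (q : Measure (Fin K → ℝ)) (ξ ξs : Fin D → ℝ) : EReal :=
  m.Lbs q + ((m.C * ∑ d, (ξ d + ξs d) : ℝ) : EReal)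

/-- `(q, ξ, ξ*)` is an optimal solution of the primal problem. -/
def IsOptimal (q : Measure (Fin K → ℝ)) (ξ ξs : Fin D → ℝ) : Prop :=
  m.Feasible q ξ ξs ∧
    ∀ q' ξ' ξs', m.Feasible q' ξ' ξs' → m.objective q ξ ξs ≤ m.objective q' ξ' ξs'

/-- The optimal value of the primal problem. -/
def primalValue : EReal :=
  ⨅ (q : Measure (Fin K → ℝ)) (ξ : Fin D → ℝ) (ξs : Fin D → ℝ) (_ : m.Feasible q ξ ξs),
    m.objective q ξ ξs

/-- The Lagrangian `L` of the primal problem, with multipliers `μ, μ*, v, v*`. -/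
def lagrangian (q : Measure (Fin K → ℝ)) (ξ ξs μ μs v vs : Fin D → ℝ) : EReal :=
  m.Lbs q + ((m.C * ∑ d, (ξ d + ξs d)
    - ∑ d, μ d * (m.ε + ξ d - m.y d + m.Emargin q d)
    - ∑ d, μs d * (m.ε + ξs d + m.y d - m.Emargin q d)
    - ∑ d, (v d * ξ d + vs d * ξs d) : ℝ) : EReal)

/-- The Lagrange dual function: the infimum of the Lagrangian over `q(η)`, `ξ` and `ξ*`. -/
def dualFunction (μ μs v vs : Fin D → ℝ) : EReal :=
  ⨅ (q : Measure (Fin K → ℝ)) (_ : m.Admissible q) (ξ : Fin D → ℝ) (ξs : Fin D → ℝ),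
    m.lagrangian q ξ ξs μ μs v vs

/-- `(μ, μ*, v, v*)` are Lagrange multipliers of the primal problem: they are nonnegative, and the
infimum of the Lagrangian is the optimal value of the primal problem. -/
def IsLagrangeMultiplier (μ μs v vs : Fin D → ℝ) : Prop :=
  (∀ d, 0 ≤ μ d ∧ 0 ≤ μs d ∧ 0 ≤ v d ∧ 0 ≤ vs d) ∧ m.dualFunction μ μs v vs = m.primalValue

/-- `E[Z̄_d]`. -/
def EZbar (d : Fin D) : Fin K → ℝ :=
  fun k => ∫ z, zbar z d k ∂m.qz

/-- `E[Z̄_d Z̄_dᵀ]`. -/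
def EZbarZbarT (d : Fin D) : Matrix (Fin K) (Fin K) ℝ :=
  Matrix.of fun i j => ∫ z, vecMulVec (zbar z d) (zbar z d) i j ∂m.qz

/-- `E[Aᵀ A]`. -/
def EAtA : Matrix (Fin K) (Fin K) ℝ :=
  Matrix.of fun i j => ∫ z, ((topicMatrix z)ᵀ * topicMatrix z) i j ∂m.qz

/-- The exponent
`ηᵀ ∑_d (μ_d - μ_d* + y_d/δ²) E[Z̄_d] - ηᵀ (E[Aᵀ A] / (2δ²)) η`. -/
def exponent (μ μs : Fin D → ℝ) (η : Fin K → ℝ) : ℝ :=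
  η ⬝ᵥ (∑ d, (μ d - μs d + m.y d / m.δsq) • m.EZbar d)
    - η ⬝ᵥ (((1 / (2 * (m.δsq : ℝ))) • m.EAtA) *ᵥ η)

/-- The normalization constant `Z`. -/
def Z (μ μs : Fin D → ℝ) : ℝ :=
  ∫ η, Real.exp (m.exponent μ μs η) ∂m.p₀

/-- The measure `q(η) = (p₀(η) / Z) exp(exponent)`. -/
def tiltedPrior (μ μs : Fin D → ℝ) : Measure (Fin K → ℝ) :=
  m.p₀.withDensity fun η => ENNReal.ofReal (Real.exp (m.exponent μ μs η) / m.Z μ μs)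

/-- The objective of the dual problem D1. -/
def D1objective (μ μs : Fin D → ℝ) : ℝ :=
  -Real.log (m.Z μ μs) - m.ε * ∑ d, (μ d + μs d) + ∑ d, m.y d * (μ d - μs d)

/-- The constraints of the dual problem D1. -/
def D1feasible (μ μs : Fin D → ℝ) : Prop :=
  ∀ d, μ d ∈ Set.Icc 0 m.C ∧ μs d ∈ Set.Icc 0 m.C

/-- `(μ, μ*)` solves the dual problem D1. -/
def SolvesD1 (μ μs : Fin D → ℝ) : Prop :=
  m.D1feasible μ μs ∧
    ∀ μ' μs', m.D1feasible μ' μs' → m.D1objective μ' μs' ≤ m.D1objective μ μs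

end MedLDA

end

/-! Under the variational law `η` is independent of the topics `(θ, z)`, and in the joint density
only the Gaussian response factor `exp(-V(η, z))` couples them. The chain rule for relative entropy
therefore gives `L^bs(q) = KL(q ‖ p₀) + E_q[∫ V(η, ·) dqz] + const`, and the inner integral is a
constant minus the exponent at zero multipliers (`Lbs_eq`). The expected margins are linear in `q`,
so the multipliers only add a linear term to that exponent. By the Gibbs variational identity the
Lagrangian equals `KL(q ‖ tiltedPrior)` plus the D1 objective, a constant, and a linear form in the
slacks (`lagrangian_eq`). The slacks are free, so the infimum is `-∞` unless the linear form
vanishes; when it does, the infimum is attained exactly at the tilted prior.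

Strong duality comes from D1 itself, without a constraint qualification. D1 maximizes a continuous
function over a compact box, and the derivatives of `log Z` are expected margins under the tilted
prior. The first-order condition, taken towards the vertex of the box where a multiplier is `C` if
its residual is positive and `0` otherwise, says that the tilted prior with hinge-loss slacks has
primal objective at most the dual value (`objective_tiltedPrior_le`). Weak duality gives equality.
An optimal `q` then has nonpositive relative entropy to the tilted prior, hence equals it.

The analytic work is finiteness. `L^bs(q)` is finite exactly when `KL(q ‖ p₀)` is finite and the
exponent is `q`-integrable (`finiteEntropy_joint_iff`); this uses that `V` is bounded below and that
the topic part has finite relative entropy. Nothing is assumed about the tails of `p₀`: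
`exponent_le` bounds the exponent above while keeping half of the quadratic term, which yields a
finite `Z` and the moments needed under the tilted prior. -/

section RelativeEntropy

/-! ### Relative entropy of products, images and reweighted measures -/

variable {X Y : Type*} [MeasurableSpace X] [MeasurableSpace Y]

/-- `μ` has finite relative entropy with respect to `ν`. -/
def FiniteEntropy (μ ν : Measure X) : Prop := μ ≪ ν ∧ Integrable (llr μ ν) μ

theorem llr_withDensity_ae {ν : Measure X} [SigmaFinite ν] {f : X → ℝ≥0∞} (hf : Measurable f) :
    llr (ν.withDensity f) ν =ᵐ[ν.withDensity f] fun x => Real.log (f x).toReal := by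
  have h := (withDensity_absolutelyContinuous ν f).ae_le (Measure.rnDeriv_withDensity ν hf)
  filter_upwards [h] with x hx
  simp only [llr, hx]

theorem rnDeriv_toReal_pos_ae {μ ν : Measure X} [SigmaFinite μ] [SigmaFinite ν] (h : μ ≪ ν) :
    ∀ᵐ x ∂μ, 0 < (μ.rnDeriv ν x).toReal := by
  filter_upwards [Measure.rnDeriv_pos h, h.ae_le (Measure.rnDeriv_lt_top μ ν)] with x h1 h2
  exact ENNReal.toReal_pos h1.ne' h2.ne

theorem llr_prod_ae {μ₁ ν₁ : Measure X} {μ₂ ν₂ : Measure Y} [SigmaFinite μ₁] [SigmaFinite ν₁]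
    [SigmaFinite μ₂] [SigmaFinite ν₂] (h₁ : μ₁ ≪ ν₁) (h₂ : μ₂ ≪ ν₂) :
    llr (μ₁.prod μ₂) (ν₁.prod ν₂) =ᵐ[μ₁.prod μ₂] fun x => llr μ₁ ν₁ x.1 + llr μ₂ ν₂ x.2 := by
  have e : μ₁.prod μ₂ = (ν₁.prod ν₂).withDensity
      fun x => μ₁.rnDeriv ν₁ x.1 * μ₂.rnDeriv ν₂ x.2 := by
    rw [← prod_withDensity (Measure.measurable_rnDeriv _ _) (Measure.measurable_rnDeriv _ _),
      Measure.withDensity_rnDeriv_eq _ _ h₁, Measure.withDensity_rnDeriv_eq _ _ h₂]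
  have hm : Measurable fun x : X × Y => μ₁.rnDeriv ν₁ x.1 * μ₂.rnDeriv ν₂ x.2 := by fun_prop
  have h := llr_withDensity_ae (ν := ν₁.prod ν₂) hm
  rw [← e] at h
  have p1 := Measure.quasiMeasurePreserving_fst (μ := μ₁) (ν := μ₂) |>.ae (rnDeriv_toReal_pos_ae h₁)
  have p2 := Measure.quasiMeasurePreserving_snd (μ := μ₁) (ν := μ₂) |>.ae (rnDeriv_toReal_pos_ae h₂)
  filter_upwards [h, p1, p2] with x hx h1 h2
  rw [hx, ENNReal.toReal_mul, Real.log_mul h1.ne' h2.ne']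
  rfl

/-- The relative density of `μ` with respect to a reweighted reference measure. -/
theorem eq_withDensity_withDensity {μ ν : Measure X} [SigmaFinite μ] [SigmaFinite ν]
    (h : μ ≪ ν) {f : X → ℝ≥0∞} (hf : Measurable f) (hf0 : ∀ᵐ x ∂μ, f x ≠ 0) (hft : ∀ x, f x ≠ ∞) :
    μ = (ν.withDensity f).withDensity fun x => μ.rnDeriv ν x * (f x)⁻¹ := by
  have hr := Measure.measurable_rnDeriv μ ν
  rw [← withDensity_mul _ hf (by fun_prop)]
  conv_lhs => rw [← Measure.withDensity_rnDeriv_eq _ _ h]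
  refine withDensity_congr_ae ?_
  rw [← Measure.withDensity_rnDeriv_eq _ _ h, ae_withDensity_iff hr] at hf0
  filter_upwards [hf0] with x hx
  by_cases h0 : μ.rnDeriv ν x = 0
  · simp [h0]
  · simp only [Pi.mul_apply]
    rw [mul_comm, mul_assoc, ENNReal.inv_mul_cancel (hx h0) (hft x), mul_one]

theorem absolutelyContinuous_withDensity_ofReal {μ ν : Measure X} [SigmaFinite μ] [SigmaFinite ν]
    (h : μ ≪ ν) {f : X → ℝ} (hf : Measurable f) (hf0 : ∀ᵐ x ∂μ, 0 < f x) :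
    μ ≪ ν.withDensity fun x => ENNReal.ofReal (f x) := by
  rw [eq_withDensity_withDensity h (f := fun x => ENNReal.ofReal (f x)) (by fun_prop)
    (by filter_upwards [hf0] with x hx using by simpa using hx) (by simp)]
  exact withDensity_absolutelyContinuous _ _

theorem llr_withDensity_ofReal_right_ae {μ ν : Measure X} [SigmaFinite μ] [SigmaFinite ν]
    (h : μ ≪ ν) {f : X → ℝ} (hf : Measurable f) (hf0 : ∀ᵐ x ∂μ, 0 < f x) :
    llr μ (ν.withDensity fun x => ENNReal.ofReal (f x)) =ᵐ[μ]
      fun x => llr μ ν x - Real.log (f x) := by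
  have e := eq_withDensity_withDensity h (f := fun x => ENNReal.ofReal (f x)) (by fun_prop)
    (by filter_upwards [hf0] with x hx using by simpa using hx) (by simp)
  have : SigmaFinite (ν.withDensity fun x => ENNReal.ofReal (f x)) :=
    SigmaFinite.withDensity_ofReal _
  have hm : Measurable fun x => μ.rnDeriv ν x * (ENNReal.ofReal (f x))⁻¹ := by
    have := Measure.measurable_rnDeriv μ ν
    fun_prop
  have h' := llr_withDensity_ae (ν := ν.withDensity fun x => ENNReal.ofReal (f x)) hm
  rw [← e] at h'
  filter_upwards [h', hf0, rnDeriv_toReal_pos_ae h] with x hx h1 h2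
  rw [hx, ENNReal.toReal_mul, ENNReal.toReal_inv, ENNReal.toReal_ofReal h1.le,
    Real.log_mul h2.ne' (by positivity), Real.log_inv, llr]
  ring

namespace FiniteEntropy

theorem refl (μ : Measure X) [SigmaFinite μ] : FiniteEntropy μ μ :=
  ⟨Measure.AbsolutelyContinuous.rfl, (integrable_congr (llr_self μ)).2 (integrable_zero _ _ _)⟩

/-- Data processing: a measurable image cannot increase relative entropy. This transfers finiteness
from Gamma products to Dirichlet laws. -/
theorem map {μ ν : Measure X} [IsFiniteMeasure μ] [IsFiniteMeasure ν] (h : FiniteEntropy μ ν)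
    {g : X → Y} (hg : Measurable g) : FiniteEntropy (μ.map g) (ν.map g) :=
  ⟨h.1.map hg, InformationTheory.integrable_llr_map h.1 hg h.2⟩

theorem prod {μ₁ ν₁ : Measure X} {μ₂ ν₂ : Measure Y} [IsFiniteMeasure μ₁] [SigmaFinite ν₁]
    [IsFiniteMeasure μ₂] [SigmaFinite ν₂] (h₁ : FiniteEntropy μ₁ ν₁) (h₂ : FiniteEntropy μ₂ ν₂) :
    FiniteEntropy (μ₁.prod μ₂) (ν₁.prod ν₂) :=
  ⟨h₁.1.prod h₂.1, (integrable_congr (llr_prod_ae h₁.1 h₂.1)).2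
    ((h₁.2.comp_fst _).add (h₂.2.comp_snd _))⟩

theorem withDensity_right {μ ν : Measure X} [SigmaFinite μ] [SigmaFinite ν]
    (h : FiniteEntropy μ ν) {f : X → ℝ} (hf : Measurable f) (hf0 : ∀ᵐ x ∂μ, 0 < f x)
    (hlog : Integrable (fun x => Real.log (f x)) μ) :
    FiniteEntropy μ (ν.withDensity fun x => ENNReal.ofReal (f x)) :=
  ⟨absolutelyContinuous_withDensity_ofReal h.1 hf hf0,
    (integrable_congr (llr_withDensity_ofReal_right_ae h.1 hf hf0)).2 (h.2.sub hlog)⟩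

theorem pi {n : ℕ} {μ ν : Fin n → Measure X} [∀ i, IsProbabilityMeasure (μ i)]
    [∀ i, IsProbabilityMeasure (ν i)] (h : ∀ i, FiniteEntropy (μ i) (ν i)) :
    FiniteEntropy (Measure.pi μ) (Measure.pi ν) := by
  induction n with
  | zero =>
    have : μ = ν := Subsingleton.elim _ _
    rw [this]
    exact refl _
  | succ n ih =>
    have e (ρ : Fin (n + 1) → Measure X) [∀ i, IsProbabilityMeasure (ρ i)] :
        Measure.pi ρ = ((ρ 0).prod (Measure.pi fun j => ρ ((0 : Fin (n + 1)).succAbove j))).map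
          (MeasurableEquiv.piFinSuccAbove (fun _ => X) 0).symm :=
      ((measurePreserving_piFinSuccAbove ρ 0).symm).map_eq.symm
    rw [e μ, e ν]
    exact ((h 0).prod (ih fun j => h _)).map (MeasurableEquiv.measurable _)

end FiniteEntropy

/-- The negative part of the log-likelihood ratio is integrable. -/
theorem integrable_llr_of_integrable_add {μ ν : Measure X} [IsFiniteMeasure μ] [IsFiniteMeasure ν]
    (h : μ ≪ ν) {U : X → ℝ} {c : ℝ} (hc : ∀ x, c ≤ U x)
    (hi : Integrable (fun x => llr μ ν x + U x) μ) : Integrable (llr μ ν) μ := by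
  -- `-llr ≤ exp(-llr)`, and `exp(-llr)` is `dν/dμ` almost everywhere, whose `μ`-integral is at most
  -- the mass of `ν`.
  have hneg : Integrable (fun x => max (-llr μ ν x) 0) μ := by
    have hlt : ∫⁻ x, ENNReal.ofReal (Real.exp (-llr μ ν x)) ∂μ < ∞ := by
      have e : ∀ᵐ x ∂μ, ENNReal.ofReal (Real.exp (-llr μ ν x)) = ν.rnDeriv μ x := by
        filter_upwards [exp_neg_llr h, Measure.rnDeriv_lt_top ν μ] with x hx h2
        rw [hx, ENNReal.ofReal_toReal h2.ne]
      rw [lintegral_congr_ae e]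
      exact (Measure.lintegral_rnDeriv_le).trans_lt (measure_lt_top _ _)
    have hexp : Integrable (fun x => Real.exp (-llr μ ν x)) μ := by
      refine ⟨((measurable_llr μ ν).neg.exp).aestronglyMeasurable, ?_⟩
      rw [hasFiniteIntegral_iff_ofReal (Filter.Eventually.of_forall fun x => (Real.exp_pos _).le)]
      exact hlt
    refine hexp.mono' ((measurable_llr μ ν).neg.max measurable_const).aestronglyMeasurable
      (Filter.Eventually.of_forall fun x => ?_)
    rw [Real.norm_eq_abs, abs_of_nonneg (le_max_right _ _)]
    refine max_le ?_ (Real.exp_pos _).le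
    linarith [Real.add_one_le_exp (-llr μ ν x)]
  -- Since `U ≥ c`, one has `|llr| ≤ |llr + U| + 2 · max(-llr, 0) + |c|`.
  refine (hi.norm.add ((hneg.const_mul 2).add (integrable_const |c|))).mono'
    (measurable_llr μ ν).aestronglyMeasurable (Filter.Eventually.of_forall fun x => ?_)
  simp only [Pi.add_apply, Real.norm_eq_abs]
  have h1 := hc x
  have h2 := le_abs_self (llr μ ν x + U x)
  have h3 := neg_abs_le c
  rcases le_total 0 (llr μ ν x) with h0 | h0
  · rw [abs_of_nonneg h0, max_eq_right (by linarith)]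
    linarith
  · rw [abs_of_nonpos h0, max_eq_left (by linarith)]
    linarith [abs_nonneg (llr μ ν x + U x), abs_nonneg c]

theorem absolutelyContinuous_of_prod_withDensity {p q : Measure X} {ν τ : Measure Y}
    [SigmaFinite τ] [IsProbabilityMeasure ν] {f : X × Y → ℝ≥0∞}
    (h : q.prod ν ≪ (p.prod τ).withDensity f) : q ≪ p := by
  have h' := h.trans (withDensity_absolutelyContinuous _ _)
  intro s hs
  have h1 : p.prod τ (s ×ˢ Set.univ) = 0 := by rw [Measure.prod_prod, hs, zero_mul]
  have h2 := h' h1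
  rwa [Measure.prod_prod, measure_univ, mul_one] at h2

section Reweighted

variable {p q : Measure X} {ν τ : Measure Y} [IsProbabilityMeasure p] [IsProbabilityMeasure q]
  [IsProbabilityMeasure ν] [SigmaFinite τ] {V : X × Y → ℝ} {c : ℝ}

theorem llr_prod_withDensity_exp_ae (hqp : q ≪ p) (hντ : ν ≪ τ) (hV : Measurable V) :
    llr (q.prod ν) ((p.prod τ).withDensity fun x => ENNReal.ofReal (Real.exp (-V x)))
      =ᵐ[q.prod ν] fun x => (llr q p x.1 + llr ν τ x.2) + V x := by
  filter_upwards [llr_withDensity_ofReal_right_ae (hqp.prod hντ) (f := fun x => Real.exp (-V x))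
    (by fun_prop) (Filter.Eventually.of_forall fun x => Real.exp_pos _),
    llr_prod_ae hqp hντ] with x h1 h2
  rw [h1, h2, Real.log_exp, sub_neg_eq_add]

theorem integrable_prod_of_integrable_integral {F : X × Y → ℝ} (hF : Measurable F)
    (hc : ∀ x, c ≤ F x) (hy : ∀ x, Integrable (fun y => F (x, y)) ν)
    (hx : Integrable (fun x => ∫ y, F (x, y) ∂ν) q) : Integrable F (q.prod ν) := by
  have h0 : Integrable (fun x => F x - c) (q.prod ν) := by
    rw [integrable_prod_iff (by fun_prop)]
    -- After subtracting the lower bound `c` the function is nonnegative, so the fibre integrals of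
    -- its norm are its own fibre integrals.
    refine ⟨Filter.Eventually.of_forall fun x => (hy x).sub (integrable_const _), ?_⟩
    have : (fun x => ∫ y, ‖F (x, y) - c‖ ∂ν) = fun x => (∫ y, F (x, y) ∂ν) - c := by
      ext x
      simp_rw [Real.norm_eq_abs, abs_of_nonneg (sub_nonneg.2 (hc _))]
      rw [integral_sub (hy x) (integrable_const _)]
      simp
    rw [this]
    exact hx.sub (integrable_const _)
  exact (h0.add (integrable_const c)).congr (Filter.Eventually.of_forall fun x => by simp)

/-- For the forward direction, integrating out `y` leaves `llr q p` plus a function bounded below.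
The negative part of `llr q p` is integrable as well, so integrability of the sum forces that of
each summand. -/
theorem finiteEntropy_prod_withDensity_iff (hντ : FiniteEntropy ν τ) (hV : Measurable V)
    (hc : ∀ x, c ≤ V x) (hy : ∀ x, Integrable (fun y => V (x, y)) ν) :
    FiniteEntropy (q.prod ν) ((p.prod τ).withDensity fun x => ENNReal.ofReal (Real.exp (-V x))) ↔
      FiniteEntropy q p ∧ Integrable (fun x => ∫ y, V (x, y) ∂ν) q := by
  constructor
  · rintro ⟨hac, hi⟩
    have hqp := absolutelyContinuous_of_prod_withDensity hac
    rw [integrable_congr (llr_prod_withDensity_exp_ae hqp hντ.1 hV)] at hi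
    have h1 : Integrable (fun x : X × Y => llr q p x.1 + V x) (q.prod ν) := by
      refine (hi.sub (hντ.2.comp_snd q)).congr (Filter.Eventually.of_forall fun x => ?_)
      simp only [Pi.sub_apply]
      ring
    have h2 : Integrable (fun x => llr q p x + ∫ y, V (x, y) ∂ν) q := by
      refine h1.integral_prod_left.congr (Filter.Eventually.of_forall fun x => ?_)
      simp only
      rw [integral_add (integrable_const _) (hy x)]
      simp
    have hcU : ∀ x, c ≤ ∫ y, V (x, y) ∂ν := fun x => by
      simpa using integral_mono (integrable_const c) (hy x) fun y => hc (x, y)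
    have h3 := integrable_llr_of_integrable_add hqp hcU h2
    refine ⟨⟨hqp, h3⟩, (h2.sub h3).congr (Filter.Eventually.of_forall fun x => ?_)⟩
    simp
  · rintro ⟨⟨hqp, hl⟩, hU⟩
    refine ⟨absolutelyContinuous_withDensity_ofReal (hqp.prod hντ.1) (by fun_prop)
      (Filter.Eventually.of_forall fun x => Real.exp_pos _), ?_⟩
    rw [integrable_congr (llr_prod_withDensity_exp_ae hqp hντ.1 hV)]
    exact ((hl.comp_fst ν).add (hντ.2.comp_snd q)).add
      (integrable_prod_of_integrable_integral hV hc hy hU)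

theorem integral_llr_prod_withDensity (hντ : FiniteEntropy ν τ) (hV : Measurable V)
    (hc : ∀ x, c ≤ V x) (hy : ∀ x, Integrable (fun y => V (x, y)) ν) (hqp : FiniteEntropy q p)
    (hU : Integrable (fun x => ∫ y, V (x, y) ∂ν) q) :
    ∫ x, llr (q.prod ν) ((p.prod τ).withDensity fun x => ENNReal.ofReal (Real.exp (-V x))) x
      ∂(q.prod ν) = ∫ x, llr q p x ∂q + ∫ x, ∫ y, V (x, y) ∂ν ∂q + ∫ y, llr ν τ y ∂ν := by
  have hVi := integrable_prod_of_integrable_integral hV hc hy hU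
  have h1 := hqp.2.comp_fst ν
  have h2 := hντ.2.comp_snd q
  rw [integral_congr_ae (llr_prod_withDensity_exp_ae hqp.1 hντ.1 hV),
    integral_add (by exact h1.add h2) hVi, integral_add h1 h2, integral_fun_fst, integral_fun_snd,
    integral_prod _ hVi]
  simp
  ring

end Reweighted

end RelativeEntropy

/-! ### Logarithmic moments and relative entropy of Gamma laws -/

section Gamma

theorem integrable_gammaMeasure_iff {a : ℝ} (ha : 0 < a) {f : ℝ → ℝ} :
    Integrable f (gammaMeasure a 1) ↔
      IntegrableOn (fun x => Real.exp (-x) * x ^ (a - 1) * f x) (Set.Ioi 0) := by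
  rw [gammaMeasure, integrable_withDensity_iff_integrable_smul' (by unfold gammaPDF; fun_prop)
    (Filter.Eventually.of_forall fun x => by simp [gammaPDF])]
  have e : (fun x => (gammaPDF a 1 x).toReal • f x) = (Set.Ici (0 : ℝ)).indicator
      fun x => (Real.Gamma a)⁻¹ * (Real.exp (-x) * x ^ (a - 1) * f x) := by
    ext x
    rw [gammaPDF, ENNReal.toReal_ofReal (gammaPDFReal_nonneg ha one_pos x), gammaPDFReal]
    by_cases hx : 0 ≤ x
    · simp [hx]
      ring
    · simp [hx]
  rw [e, integrable_indicator_iff measurableSet_Ici, IntegrableOn,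
    integrable_const_mul_iff (by simpa using (Real.Gamma_pos_of_pos ha).ne'), ← IntegrableOn,
    integrableOn_Ici_iff_integrableOn_Ioi]

theorem integrable_rpow_gammaMeasure {a s : ℝ} (ha : 0 < a) (hs : 0 < a + s) :
    Integrable (fun x => x ^ s) (gammaMeasure a 1) := by
  rw [integrable_gammaMeasure_iff ha]
  refine (Real.GammaIntegral_convergent hs).congr_fun (fun x hx => ?_) measurableSet_Ioi
  simp only
  rw [mul_assoc, ← Real.rpow_add hx]
  ring_nf

theorem gammaMeasure_pos_ae (a : ℝ) : ∀ᵐ x ∂gammaMeasure a 1, 0 < x := by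
  rw [gammaMeasure, ae_withDensity_iff (by unfold gammaPDF; fun_prop)]
  have h0 : ∀ᵐ x : ℝ, x ≠ 0 := by simp [ae_iff]
  filter_upwards [h0] with x h0 hx
  by_contra h
  exact hx (gammaPDF_of_neg (lt_of_le_of_ne (not_lt.1 h) h0))

theorem abs_log_le_rpow_add_rpow {x e : ℝ} (hx : 0 < x) (he : 0 < e) :
    |Real.log x| ≤ x ^ e / e + x ^ (-e) / e := by
  have h1 := Real.log_le_rpow_div hx.le he
  have h2 := Real.log_le_rpow_div (inv_pos.2 hx).le he
  rw [Real.log_inv, Real.inv_rpow hx.le, ← Real.rpow_neg hx.le] at h2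
  have h3 : 0 ≤ x ^ e / e := by positivity
  have h4 : 0 ≤ x ^ (-e) / e := by positivity
  rw [abs_le]
  constructor <;> linarith

theorem integrable_log_gammaMeasure {a : ℝ} (ha : 0 < a) :
    Integrable Real.log (gammaMeasure a 1) := by
  -- The exponents `±a/2` keep `a + s` positive, so both powers dominating `|log x|` are integrable.
  refine (((integrable_rpow_gammaMeasure ha (s := a / 2) (by linarith)).div_const (a / 2)).add
    ((integrable_rpow_gammaMeasure ha (s := -(a / 2)) (by linarith)).div_const (a / 2))).mono'
    Real.measurable_log.aestronglyMeasurable ?_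
  filter_upwards [gammaMeasure_pos_ae a] with x hx
  exact abs_log_le_rpow_add_rpow hx (by linarith)

theorem finiteEntropy_gammaMeasure {a b : ℝ} (ha : 0 < a) (hb : 0 < b) :
    FiniteEntropy (gammaMeasure a 1) (gammaMeasure b 1) := by
  have := isProbabilityMeasure_gammaMeasure ha one_pos
  -- Lebesgue measure serves as intermediate reference: the log-density of either Gamma law is
  -- affine in `log x` and `x`, both integrable under `gammaMeasure a 1`.
  have h0 : FiniteEntropy (gammaMeasure a 1) (volume : Measure ℝ) := by
    refine ⟨withDensity_absolutelyContinuous _ _, ?_⟩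
    rw [gammaMeasure, integrable_congr (llr_withDensity_ae (by unfold gammaPDF; fun_prop)),
      ← gammaMeasure]
    have hi : Integrable (fun x => -Real.log (Real.Gamma a) + (a - 1) * Real.log x - x ^ (1 : ℝ))
        (gammaMeasure a 1) :=
      ((integrable_const _).add ((integrable_log_gammaMeasure ha).const_mul _)).sub
        (integrable_rpow_gammaMeasure ha (by linarith))
    refine hi.congr ?_
    filter_upwards [gammaMeasure_pos_ae a] with x hx
    have := Real.Gamma_pos_of_pos ha
    rw [gammaPDF, ENNReal.toReal_ofReal (gammaPDFReal_nonneg ha one_pos x), gammaPDFReal,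
      if_pos hx.le, Real.log_mul (by positivity) (by positivity),
      Real.log_mul (by positivity) (by positivity), Real.log_rpow hx, Real.log_exp]
    simp
    ring
  have hpos : ∀ᵐ x ∂gammaMeasure a 1, 0 < gammaPDFReal b 1 x := by
    filter_upwards [gammaMeasure_pos_ae a] with x hx using gammaPDFReal_pos hb one_pos hx
  refine h0.withDensity_right (measurable_gammaPDFReal b 1) hpos ?_
  have hi : Integrable (fun x => -Real.log (Real.Gamma b) + (b - 1) * Real.log x - x ^ (1 : ℝ))
      (gammaMeasure a 1) :=
    ((integrable_const _).add ((integrable_log_gammaMeasure ha).const_mul _)).sub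
      (integrable_rpow_gammaMeasure ha (by linarith))
  refine hi.congr ?_
  filter_upwards [gammaMeasure_pos_ae a] with x hx
  have := Real.Gamma_pos_of_pos hb
  rw [gammaPDFReal, if_pos hx.le, Real.log_mul (by positivity) (by positivity),
    Real.log_mul (by positivity) (by positivity), Real.log_rpow hx, Real.log_exp]
  simp
  ring

end Gamma

/-! ### Dirichlet laws as normalized Gamma vectors -/

section Dirichlet

variable {K : ℕ} {a b : Fin K → ℝ}

theorem measurable_normalize : Measurable fun (g : Fin K → ℝ) k => g k / ∑ j, g j := by
  fun_prop

theorem isProbabilityMeasure_dirichletMeasure (ha : ∀ k, 0 < a k) :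
    IsProbabilityMeasure (dirichletMeasure a) := by
  have (j : Fin K) := isProbabilityMeasure_gammaMeasure (ha j) one_pos
  exact Measure.isProbabilityMeasure_map measurable_normalize.aemeasurable

theorem finiteEntropy_dirichletMeasure (ha : ∀ k, 0 < a k) (hb : ∀ k, 0 < b k) :
    FiniteEntropy (dirichletMeasure a) (dirichletMeasure b) := by
  have (j : Fin K) := isProbabilityMeasure_gammaMeasure (ha j) one_pos
  have (j : Fin K) := isProbabilityMeasure_gammaMeasure (hb j) one_pos
  exact (FiniteEntropy.pi fun k => finiteEntropy_gammaMeasure (ha k) (hb k)).map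
    measurable_normalize

theorem pi_gammaMeasure_pos_ae (ha : ∀ k, 0 < a k) :
    ∀ᵐ g ∂Measure.pi fun k => gammaMeasure (a k) 1, ∀ k, 0 < g k := by
  have (j : Fin K) := isProbabilityMeasure_gammaMeasure (ha j) one_pos
  exact ae_all_iff.2 fun k => (Measure.quasiMeasurePreserving_eval
    (μ := fun k => gammaMeasure (a k) 1) k).ae (gammaMeasure_pos_ae (a k))

theorem dirichletMeasure_pos_ae (ha : ∀ k, 0 < a k) :
    ∀ᵐ θ ∂dirichletMeasure a, ∀ k, 0 < θ k := by
  refine (ae_map_iff measurable_normalize.aemeasurable ?_).2 ?_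
  · rw [Set.ofPred_forall]
    exact MeasurableSet.iInter fun k => measurableSet_lt measurable_const (measurable_pi_apply k)
  filter_upwards [pi_gammaMeasure_pos_ae ha] with g hg k
  exact div_pos (hg k) (Finset.sum_pos (fun j _ => hg j) ⟨k, Finset.mem_univ k⟩)

theorem integrable_log_dirichletMeasure (ha : ∀ k, 0 < a k) (k : Fin K) :
    Integrable (fun θ => Real.log (θ k)) (dirichletMeasure a) := by
  have (j : Fin K) := isProbabilityMeasure_gammaMeasure (ha j) one_pos
  refine (integrable_map_measure
    (Real.measurable_log.comp (measurable_pi_apply k)).aestronglyMeasurable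
    measurable_normalize.aemeasurable).2 ?_
  have h1 : Integrable (fun g : Fin K → ℝ => ∑ j, g j) (Measure.pi fun k => gammaMeasure (a k) 1) :=
    integrable_finsetSum _ fun j _ => integrable_comp_eval (f := fun x => x) (by
      have := integrable_rpow_gammaMeasure (ha j) (s := 1) (by linarith [ha j])
      simpa using this)
  have h2 : Integrable (fun g : Fin K → ℝ => |Real.log (g k)|)
      (Measure.pi fun k => gammaMeasure (a k) 1) :=
    (integrable_comp_eval (integrable_log_gammaMeasure (ha k))).abs
  -- With `S = ∑ g_j ≥ g_k`, `|log(g_k / S)| = log S - log g_k ≤ S - 1 + |log g_k|`.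
  refine (h1.add h2).mono' (((Real.measurable_log.comp (measurable_pi_apply k)).comp
    measurable_normalize).aestronglyMeasurable) ?_
  filter_upwards [pi_gammaMeasure_pos_ae ha] with g hg
  have hS : g k ≤ ∑ j, g j :=
    Finset.single_le_sum (f := g) (fun j _ => (hg j).le) (Finset.mem_univ k)
  have hS0 : 0 < ∑ j, g j := (hg k).trans_le hS
  have h3 := Real.log_le_log (hg k) hS
  have h4 := Real.log_le_sub_one_of_pos hS0
  simp only [Function.comp_apply, Pi.add_apply, Real.norm_eq_abs]
  rw [Real.log_div (hg k).ne' hS0.ne', abs_of_nonpos (by linarith)]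
  linarith [neg_abs_le (Real.log (g k))]

end Dirichlet

/-! ### Categorical laws -/

section Categorical

variable {K : ℕ} {p : Fin K → ℝ}

theorem isProbabilityMeasure_categoricalMeasure (hp : ∀ k, 0 ≤ p k) (h1 : ∑ k, p k = 1) :
    IsProbabilityMeasure (categoricalMeasure p) := by
  constructor
  simp only [categoricalMeasure, Measure.coe_finsetSum, Finset.sum_apply, Measure.smul_apply,
    measure_univ, smul_eq_mul, mul_one]
  rw [← ENNReal.ofReal_sum_of_nonneg fun k _ => hp k, h1, ENNReal.ofReal_one]

theorem integral_categoricalMeasure (hp : ∀ k, 0 ≤ p k) (f : Fin K → ℝ) :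
    ∫ k, f k ∂categoricalMeasure p = ∑ k, p k * f k := by
  have : ∀ k, IsFiniteMeasure (ENNReal.ofReal (p k) • Measure.dirac k) := fun k =>
    Measure.smul_finite _ ENNReal.ofReal_ne_top
  rw [categoricalMeasure, integral_finsetSum_measure fun k _ => Integrable.of_finite]
  refine Finset.sum_congr rfl fun k _ => ?_
  rw [integral_smul_measure, integral_dirac, ENNReal.toReal_ofReal (hp k), smul_eq_mul]

theorem categoricalMeasure_ne_zero_ae : ∀ᵐ k ∂categoricalMeasure p, p k ≠ 0 := by
  rw [ae_iff, categoricalMeasure]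
  simp only [Measure.coe_finsetSum, Finset.sum_apply, Measure.smul_apply, smul_eq_mul,
    Finset.sum_eq_zero_iff, Finset.mem_univ, forall_const, mul_eq_zero]
  intro k
  by_cases h : p k = 0 <;> simp [h]

end Categorical

/-! ### Moments of the topic assignments -/

theorem zbar_apply {K D N : ℕ} (z : Assignment K D N) (d : Fin D) (k : Fin K) :
    zbar z d k = (1 / (N : ℝ)) * ∑ n, if z d n = k then (1 : ℝ) else 0 := by
  simp [zbar, Finset.sum_apply, Pi.single_apply, eq_comm]

namespace MedLDA

variable {K D N M : ℕ} {m : MedLDA K D N M}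

/-- The hypotheses on the data under which the duality theorem holds. -/
structure IsRegular (m : MedLDA K D N M) : Prop where
  pos_C : 0 < m.C
  pos_δsq : 0 < m.δsq
  prob : IsProbabilityMeasure m.p₀
  pos_α : ∀ k, 0 < m.α k
  nonneg_β : ∀ k v, 0 ≤ m.β k v
  pos_γ : ∀ d k, 0 < m.γ d k
  nonneg_φ : ∀ d n k, 0 ≤ m.φ d n k
  sum_φ : ∀ d n, ∑ k, m.φ d n k = 1
  support : ∀ d n k, m.φ d n k ≠ 0 → m.β k (m.w d n) ≠ 0

namespace IsRegular

theorem prob_categorical (h : m.IsRegular) (d : Fin D) (n : Fin N) :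
    IsProbabilityMeasure (categoricalMeasure (m.φ d n)) :=
  isProbabilityMeasure_categoricalMeasure (h.nonneg_φ d n) (h.sum_φ d n)

theorem prob_pi_categorical (h : m.IsRegular) (d : Fin D) :
    IsProbabilityMeasure (Measure.pi fun n => categoricalMeasure (m.φ d n)) := by
  have := h.prob_categorical d
  infer_instance

theorem prob_qz (h : m.IsRegular) : IsProbabilityMeasure m.qz := by
  have := h.prob_pi_categorical
  unfold qz
  infer_instance

theorem integrable_qz (h : m.IsRegular) (f : Assignment K D N → ℝ) : Integrable f m.qz := by
  have := h.prob_qz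
  exact Integrable.of_finite

theorem integral_qz_document (h : m.IsRegular) (d : Fin D) (f : (Fin N → Fin K) → ℝ) :
    ∫ z, f (z d) ∂m.qz = ∫ u, f u ∂Measure.pi fun n => categoricalMeasure (m.φ d n) := by
  have := h.prob_pi_categorical
  exact integral_comp_eval (μ := fun d => Measure.pi fun n => categoricalMeasure (m.φ d n))
    (measurable_of_finite f).aestronglyMeasurable

theorem integral_qz_word (h : m.IsRegular) (d : Fin D) (n : Fin N) (f : Fin K → ℝ) :
    ∫ z, f (z d n) ∂m.qz = ∑ k, m.φ d n k * f k := by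
  have := h.prob_categorical d
  rw [h.integral_qz_document d fun u => f (u n),
    integral_comp_eval (μ := fun n => categoricalMeasure (m.φ d n))
      (measurable_of_finite f).aestronglyMeasurable,
    integral_categoricalMeasure (h.nonneg_φ d n)]

theorem integral_qz_word_mul (h : m.IsRegular) (d : Fin D) {n n' : Fin N} (hn : n ≠ n')
    (f g : Fin K → ℝ) :
    ∫ z, f (z d n) * g (z d n') ∂m.qz = (∑ k, m.φ d n k * f k) * ∑ k, m.φ d n' k * g k := by
  have := h.prob_categorical d
  rw [← h.integral_qz_word d n f, ← h.integral_qz_word d n' g,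
    h.integral_qz_document d fun u => f (u n) * g (u n'), h.integral_qz_document d fun u => f (u n),
    h.integral_qz_document d fun u => g (u n')]
  have hi := (iIndepFun_pi (μ := fun n => categoricalMeasure (m.φ d n)) (X := fun _ k => k)
    fun _ => aemeasurable_id).indepFun hn
  exact hi.integral_fun_comp_mul_comp (measurable_pi_apply n).aemeasurable
    (measurable_pi_apply n').aemeasurable (measurable_of_finite f).aestronglyMeasurable
    (measurable_of_finite g).aestronglyMeasurable

theorem EZbar_eq (h : m.IsRegular) (d : Fin D) : m.EZbar d = (1 / (N : ℝ)) • ∑ n, m.φ d n := by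
  ext k
  simp only [EZbar, zbar_apply]
  rw [integral_const_mul, integral_finsetSum _ fun n _ => h.integrable_qz _]
  simp only [Pi.smul_apply, Finset.sum_apply, smul_eq_mul]
  congr 1
  refine Finset.sum_congr rfl fun n _ => ?_
  rw [h.integral_qz_word d n fun j => if j = k then (1 : ℝ) else 0]
  simp

theorem EAtA_eq (h : m.IsRegular) : m.EAtA = ∑ d, m.EZbarZbarT d := by
  ext i j
  simp only [EAtA, EZbarZbarT, Matrix.of_apply, Matrix.sum_apply]
  rw [← integral_finsetSum _ fun d _ => h.integrable_qz _]
  refine integral_congr_ae (Filter.Eventually.of_forall fun z => ?_)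
  simp [Matrix.mul_apply, topicMatrix, vecMulVec_apply]

/-- Distinct words are independent and contribute products of means; for a single word the product
of two indicators is an indicator or zero, which gives the diagonal matrix. -/
theorem EZbarZbarT_eq (h : m.IsRegular) (d : Fin D) :
    m.EZbarZbarT d = (1 / (N : ℝ) ^ 2) •
      ((∑ n, ∑ n' ∈ Finset.univ.erase n, vecMulVec (m.φ d n) (m.φ d n'))
        + ∑ n, Matrix.diagonal (m.φ d n)) := by
  ext i j
  have e (z : Assignment K D N) : vecMulVec (zbar z d) (zbar z d) i j =
      (1 / (N : ℝ) ^ 2) * ∑ n, ∑ n', (if z d n = i then (1 : ℝ) else 0) *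
        (if z d n' = j then (1 : ℝ) else 0) := by
    rw [vecMulVec_apply, zbar_apply, zbar_apply, ← Finset.sum_mul_sum]
    ring
  simp only [EZbarZbarT, Matrix.of_apply, e]
  rw [integral_const_mul, integral_finsetSum _ fun n _ => h.integrable_qz _]
  simp only [Matrix.smul_apply, Matrix.add_apply, Matrix.sum_apply, smul_eq_mul]
  rw [← Finset.sum_add_distrib]
  congr 1
  refine Finset.sum_congr rfl fun n _ => ?_
  rw [integral_finsetSum _ fun n _ => h.integrable_qz _,
    ← Finset.sum_erase_add _ _ (Finset.mem_univ n)]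
  congr 1
  · refine Finset.sum_congr rfl fun n' hn' => ?_
    rw [h.integral_qz_word_mul d (Finset.ne_of_mem_erase hn').symm
      (fun k => if k = i then (1 : ℝ) else 0) fun k => if k = j then (1 : ℝ) else 0]
    simp [vecMulVec_apply]
  · rw [h.integral_qz_word d n fun k => (if k = i then (1 : ℝ) else 0) *
      (if k = j then (1 : ℝ) else 0)]
    by_cases hij : i = j
    · subst hij
      simp
    · rw [Matrix.diagonal_apply_ne _ hij]
      refine Finset.sum_eq_zero fun k _ => ?_
      by_cases hk : k = i
      · simp [hk, hij]
      · simp [hk]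

end IsRegular

end MedLDA

/-! ### Factorization of the joint and the formula for `L^bs` -/

namespace MedLDA

variable {K D N M : ℕ} {m : MedLDA K D N M}

/-- The likelihood of the topic assignments and the words. -/
noncomputable def topicLikelihood (m : MedLDA K D N M)
    (x : (Fin D → Fin K → ℝ) × Assignment K D N) :
    ℝ :=
  ∏ d, ∏ n, x.1 d (x.2 d n) * m.β (x.2 d n) (m.w d n)

/-- The negative log-likelihood of the responses. -/
noncomputable def responseLoss (m : MedLDA K D N M) (η : Fin K → ℝ) (z : Assignment K D N) : ℝ :=
  ∑ d, ((m.y d - η ⬝ᵥ zbar z d) ^ 2 / (2 * m.δsq) + Real.log √(2 * Real.pi * m.δsq))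

/-- The variational distribution of `(θ, z)`. -/
noncomputable def variationalTopics (m : MedLDA K D N M) :
    Measure ((Fin D → Fin K → ℝ) × Assignment K D N) :=
  (Measure.pi fun d => dirichletMeasure (m.γ d)).prod m.qz

/-- The joint of `(θ, z, W)` at the observed `W`. -/
noncomputable def jointTopics (m : MedLDA K D N M) :
    Measure ((Fin D → Fin K → ℝ) × Assignment K D N) :=
  ((Measure.pi fun _ => dirichletMeasure m.α).prod Measure.count).withDensity
    fun x => ENNReal.ofReal (m.topicLikelihood x)

/-- The assignment space is finite, so measurability may be checked with the assignment fixed. -/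
theorem measurable_of_discrete_snd {X Y : Type*} [MeasurableSpace X] [Finite Y]
    [MeasurableSpace Y] [MeasurableSingletonClass Y] {F : X × Y → ℝ}
    (hF : ∀ y, Measurable fun x => F (x, y)) : Measurable F :=
  measurable_from_prod_countable_left hF

theorem measurable_dotProduct_const (a : Fin K → ℝ) : Measurable fun η : Fin K → ℝ => η ⬝ᵥ a := by
  unfold dotProduct
  fun_prop

theorem measurable_topicLikelihood : Measurable m.topicLikelihood := by
  refine measurable_of_discrete_snd fun z => ?_
  have (d : Fin D) (n : Fin N) : Measurable fun θ : Fin D → Fin K → ℝ => θ d (z d n) := by fun_prop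
  unfold topicLikelihood
  dsimp only
  fun_prop

theorem measurable_responseLoss :
    Measurable fun x : (Fin K → ℝ) × Assignment K D N => m.responseLoss x.1 x.2 := by
  refine measurable_of_discrete_snd fun z => ?_
  have (d : Fin D) := measurable_dotProduct_const (zbar z d)
  unfold responseLoss
  fun_prop

theorem measurable_responseLoss_latent :
    Measurable fun x : Latent K D N => m.responseLoss x.1 x.2.2 := by
  have h : Measurable fun x : Latent K D N => (x.1, x.2.2) := by fun_prop
  have h' := (measurable_responseLoss (m := m)).comp h
  simp only [Function.comp_def] at h'
  exact h'

theorem variational_eq (q : Measure (Fin K → ℝ)) : m.variational q = q.prod m.variationalTopics :=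
  rfl

namespace IsRegular

theorem prob_pi_dirichlet (h : m.IsRegular) :
    IsProbabilityMeasure (Measure.pi fun d => dirichletMeasure (m.γ d)) := by
  have (d : Fin D) := isProbabilityMeasure_dirichletMeasure (h.pos_γ d)
  infer_instance

theorem prob_variationalTopics (h : m.IsRegular) : IsProbabilityMeasure m.variationalTopics := by
  have := h.prob_qz
  have := h.prob_pi_dirichlet
  unfold variationalTopics
  infer_instance

theorem finite_prior (h : m.IsRegular) : IsFiniteMeasure
    ((Measure.pi fun _ : Fin D => dirichletMeasure m.α).prod
      (Measure.count : Measure (Assignment K D N))) := by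
  have := isProbabilityMeasure_dirichletMeasure h.pos_α
  infer_instance

theorem prod_gaussianPDFReal_eq (h : m.IsRegular) (η : Fin K → ℝ) (z : Assignment K D N) :
    ∏ d, gaussianPDFReal (η ⬝ᵥ zbar z d) m.δsq (m.y d) = Real.exp (-m.responseLoss η z) := by
  have hδ : (0 : ℝ) < m.δsq := by exact_mod_cast h.pos_δsq
  rw [responseLoss, ← Finset.sum_neg_distrib, Real.exp_sum]
  refine Finset.prod_congr rfl fun d _ => ?_
  rw [gaussianPDFReal, neg_add, Real.exp_add, Real.exp_neg (Real.log _),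
    Real.exp_log (by positivity), mul_comm, neg_div]

/-- Isolates the only factor involving both `η` and `z`; all other factors are absorbed into
`jointTopics`, matching the product form of the variational law. -/
theorem joint_eq (h : m.IsRegular) : m.joint = (m.p₀.prod m.jointTopics).withDensity
    fun x => ENNReal.ofReal (Real.exp (-m.responseLoss x.1 x.2.2)) := by
  have := h.prob
  have := h.finite_prior
  have hA : Measurable fun x => ENNReal.ofReal (m.topicLikelihood x) :=
    measurable_topicLikelihood.ennreal_ofReal
  have : SigmaFinite (((Measure.pi fun _ : Fin D => dirichletMeasure m.α).prod
      (Measure.count : Measure (Assignment K D N))).withDensity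
        fun x => ENNReal.ofReal (m.topicLikelihood x)) := SigmaFinite.withDensity_ofReal _
  have hA' : Measurable fun x : Latent K D N => ENNReal.ofReal (m.topicLikelihood x.2) :=
    hA.comp measurable_snd
  have hV : Measurable fun x : Latent K D N =>
      ENNReal.ofReal (Real.exp (-m.responseLoss x.1 x.2.2)) :=
    (measurable_responseLoss_latent (m := m)).neg.exp.ennreal_ofReal
  rw [jointTopics, prod_withDensity_right hA, ← withDensity_mul _ hA' hV, joint]
  congr 1
  ext x
  rw [Finset.prod_mul_distrib, h.prod_gaussianPDFReal_eq, ENNReal.ofReal_mul' (Real.exp_pos _).le]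
  rfl

theorem qz_support_ae (h : m.IsRegular) : ∀ᵐ z ∂m.qz, ∀ d n, 0 < m.β (z d n) (m.w d n) := by
  have := h.prob_categorical
  have := h.prob_pi_categorical
  refine ae_all_iff.2 fun d => ae_all_iff.2 fun n => ?_
  have h1 : ∀ᵐ u ∂Measure.pi fun n => categoricalMeasure (m.φ d n), m.φ d n (u n) ≠ 0 :=
    (Measure.quasiMeasurePreserving_eval (μ := fun n => categoricalMeasure (m.φ d n)) n).ae
      categoricalMeasure_ne_zero_ae
  have h2 : ∀ᵐ z ∂m.qz, m.φ d n (z d n) ≠ 0 := (Measure.quasiMeasurePreserving_eval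
    (μ := fun d => Measure.pi fun n => categoricalMeasure (m.φ d n)) d).ae h1
  filter_upwards [h2] with z hz
  exact lt_of_le_of_ne (h.nonneg_β _ _) (h.support d n _ hz).symm

theorem topic_proportions_pos_ae (h : m.IsRegular) :
    ∀ᵐ x ∂m.variationalTopics, ∀ d k, 0 < x.1 d k := by
  have (d : Fin D) := isProbabilityMeasure_dirichletMeasure (h.pos_γ d)
  have h1 : ∀ᵐ θ ∂Measure.pi fun d => dirichletMeasure (m.γ d), ∀ d k, 0 < θ d k :=
    ae_all_iff.2 fun d => (Measure.quasiMeasurePreserving_eval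
      (μ := fun d => dirichletMeasure (m.γ d)) d).ae (dirichletMeasure_pos_ae (h.pos_γ d))
  exact Measure.quasiMeasurePreserving_fst.ae h1

theorem word_probabilities_pos_ae (h : m.IsRegular) :
    ∀ᵐ x ∂m.variationalTopics, ∀ d n, 0 < m.β (x.2 d n) (m.w d n) := by
  have := h.prob_qz
  exact Measure.quasiMeasurePreserving_snd.ae h.qz_support_ae

theorem integrable_log_topicLikelihood (h : m.IsRegular) :
    Integrable (fun x => Real.log (m.topicLikelihood x)) m.variationalTopics := by
  have := h.prob_qz
  have := h.prob_pi_dirichlet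
  have (d : Fin D) := isProbabilityMeasure_dirichletMeasure (h.pos_γ d)
  have hθ (d : Fin D) (k : Fin K) : Integrable
      (fun x : (Fin D → Fin K → ℝ) × Assignment K D N => Real.log (x.1 d k)) m.variationalTopics :=
    (integrable_comp_eval (μ := fun d => dirichletMeasure (m.γ d)) (f := fun v => Real.log (v k))
      (integrable_log_dirichletMeasure (h.pos_γ d) k)).comp_fst m.qz
  have hβ : Integrable (fun x : (Fin D → Fin K → ℝ) × Assignment K D N =>
      ∑ d, ∑ n, |Real.log (m.β (x.2 d n) (m.w d n))|) m.variationalTopics :=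
    (h.integrable_qz fun z => ∑ d, ∑ n, |Real.log (m.β (z d n) (m.w d n))|).comp_snd _
  -- Summing over all topics `k` gives a dominating function of `θ` that does not depend on which
  -- topics `z` selects.
  have hb : Integrable (fun x : (Fin D → Fin K → ℝ) × Assignment K D N =>
      (∑ d, ∑ _n : Fin N, ∑ k, |Real.log (x.1 d k)|) +
        ∑ d, ∑ n, |Real.log (m.β (x.2 d n) (m.w d n))|) m.variationalTopics :=
    (integrable_finsetSum _ fun d _ => integrable_finsetSum _ fun _ _ =>
      integrable_finsetSum _ fun k _ => (hθ d k).abs).add hβ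
  refine hb.mono' (Real.measurable_log.comp measurable_topicLikelihood).aestronglyMeasurable ?_
  filter_upwards [h.topic_proportions_pos_ae, h.word_probabilities_pos_ae] with x h1 h2
  rw [topicLikelihood, Real.log_prod fun d _ => (Finset.prod_pos fun n _ =>
    mul_pos (h1 _ _) (h2 _ _)).ne', ← Finset.sum_add_distrib]
  refine (Finset.abs_sum_le_sum_abs _ _).trans (Finset.sum_le_sum fun d _ => ?_)
  rw [Real.log_prod fun n _ => (mul_pos (h1 _ _) (h2 _ _)).ne', ← Finset.sum_add_distrib]
  refine (Finset.abs_sum_le_sum_abs _ _).trans (Finset.sum_le_sum fun n _ => ?_)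
  rw [Real.log_mul (h1 _ _).ne' (h2 _ _).ne']
  refine (abs_add_le _ _).trans (add_le_add ?_ le_rfl)
  exact Finset.single_le_sum (f := fun k => |Real.log (x.1 d k)|) (fun k _ => abs_nonneg _)
    (Finset.mem_univ _)

theorem finiteEntropy_topics (h : m.IsRegular) :
    FiniteEntropy m.variationalTopics m.jointTopics := by
  have := h.prob_qz
  have := h.prob_pi_dirichlet
  have := h.finite_prior
  have := h.prob_variationalTopics
  have (d : Fin D) := isProbabilityMeasure_dirichletMeasure (h.pos_γ d)
  have := isProbabilityMeasure_dirichletMeasure h.pos_α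
  -- Only the empty set is null for counting measure, and every function on the finite assignment
  -- space is integrable.
  have hqz : FiniteEntropy m.qz Measure.count :=
    ⟨fun s hs => by simp [Measure.count_eq_zero_iff.1 hs], h.integrable_qz _⟩
  refine ((FiniteEntropy.pi fun d => finiteEntropy_dirichletMeasure (h.pos_γ d) h.pos_α).prod
    hqz).withDensity_right measurable_topicLikelihood ?_ h.integrable_log_topicLikelihood
  filter_upwards [h.topic_proportions_pos_ae, h.word_probabilities_pos_ae] with x h1 h2
  exact Finset.prod_pos fun d _ => Finset.prod_pos fun n _ => mul_pos (h1 _ _) (h2 _ _)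

theorem integral_variationalTopics_snd (h : m.IsRegular) (f : Assignment K D N → ℝ) :
    ∫ x, f x.2 ∂m.variationalTopics = ∫ z, f z ∂m.qz := by
  have := h.prob_qz
  have := h.prob_pi_dirichlet
  rw [variationalTopics, integral_fun_snd]
  simp

theorem integrable_variationalTopics_snd (h : m.IsRegular) (f : Assignment K D N → ℝ) :
    Integrable (fun x => f x.2) m.variationalTopics := by
  have := h.prob_qz
  have := h.prob_pi_dirichlet
  exact (h.integrable_qz f).comp_snd _

/-! ### The exponent -/

theorem dotProduct_EZbar (h : m.IsRegular) (η : Fin K → ℝ) (d : Fin D) :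
    η ⬝ᵥ m.EZbar d = ∫ z, η ⬝ᵥ zbar z d ∂m.qz := by
  simp only [dotProduct, EZbar]
  rw [integral_finsetSum _ fun k _ => h.integrable_qz _]
  simp only [integral_const_mul]

theorem dotProduct_EAtA (h : m.IsRegular) (η : Fin K → ℝ) :
    η ⬝ᵥ (m.EAtA *ᵥ η) = ∫ z, ∑ d, (η ⬝ᵥ zbar z d) ^ 2 ∂m.qz := by
  have e (z : Assignment K D N) : ∑ d, (η ⬝ᵥ zbar z d) ^ 2 =
      ∑ i, ∑ j, η i * (((topicMatrix z)ᵀ * topicMatrix z) i j * η j) := by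
    have e1 : ∑ d, (η ⬝ᵥ zbar z d) ^ 2 = (topicMatrix z *ᵥ η) ⬝ᵥ (topicMatrix z *ᵥ η) := by
      refine Finset.sum_congr rfl fun d _ => ?_
      rw [dotProduct_comm, sq]
      rfl
    rw [e1, dotProduct_mulVec, vecMul_mulVec, ← dotProduct_mulVec]
    simp only [dotProduct, mulVec, Finset.mul_sum]
  simp only [e]
  rw [integral_finsetSum _ fun k _ => h.integrable_qz _]
  simp only [dotProduct, mulVec, Finset.mul_sum]
  refine Finset.sum_congr rfl fun i _ => ?_
  rw [integral_finsetSum _ fun k _ => h.integrable_qz _]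
  refine Finset.sum_congr rfl fun j _ => ?_
  rw [integral_const_mul, integral_mul_const]
  rfl

end IsRegular

/-- The part of the response loss that does not depend on `η`. -/
noncomputable def constantLoss (m : MedLDA K D N M) : ℝ :=
  ∑ d, (m.y d ^ 2 / (2 * m.δsq) + Real.log √(2 * Real.pi * m.δsq))

/-- The multipliers enter linearly, through the same functions of `η` whose means are the expected
margins; hence the Lagrange terms can be absorbed into the exponent. -/
theorem exponent_eq_add (μ μs : Fin D → ℝ) (η : Fin K → ℝ) :
    m.exponent μ μs η = ∑ d, (μ d - μs d) * (η ⬝ᵥ m.EZbar d) + m.exponent 0 0 η := by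
  simp only [exponent, dotProduct_sum, dotProduct_smul, smul_eq_mul, Pi.zero_apply, sub_zero,
    zero_add, add_mul, Finset.sum_add_distrib]
  ring

theorem IsRegular.integral_responseLoss (h : m.IsRegular) (η : Fin K → ℝ) :
    ∫ z, m.responseLoss η z ∂m.qz = m.constantLoss - m.exponent 0 0 η := by
  have hδ : (0 : ℝ) < m.δsq := by exact_mod_cast h.pos_δsq
  have := h.prob_qz
  have e (z : Assignment K D N) : m.responseLoss η z = m.constantLoss
      - ∑ d, m.y d / m.δsq * (η ⬝ᵥ zbar z d)
      + 1 / (2 * (m.δsq : ℝ)) * ∑ d, (η ⬝ᵥ zbar z d) ^ 2 := by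
    rw [responseLoss, constantLoss, Finset.mul_sum, ← Finset.sum_sub_distrib,
      ← Finset.sum_add_distrib]
    refine Finset.sum_congr rfl fun d _ => ?_
    field_simp
    ring
  simp only [e]
  rw [integral_add (h.integrable_qz _) (h.integrable_qz _),
    integral_sub (h.integrable_qz _) (h.integrable_qz _), integral_const_mul, ← h.dotProduct_EAtA,
    integral_finsetSum _ fun k _ => h.integrable_qz _]
  simp only [integral_const_mul, ← h.dotProduct_EZbar, exponent, dotProduct_sum, dotProduct_smul,
    smul_eq_mul, Pi.zero_apply, sub_zero, zero_add, smul_mulVec, integral_const, probReal_univ]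
  ring

/-- The additive constant between the Lagrange dual function and the objective of D1. -/
noncomputable def dualConstant (m : MedLDA K D N M) : ℝ :=
  m.constantLoss + ∫ x, llr m.variationalTopics m.jointTopics x ∂m.variationalTopics

theorem measurable_exponent (μ μs : Fin D → ℝ) : Measurable (m.exponent μ μs) := by
  have h1 := measurable_dotProduct_const (∑ d, (μ d - μs d + m.y d / m.δsq) • m.EZbar d)
  unfold exponent
  refine h1.sub ?_
  unfold dotProduct mulVec dotProduct
  fun_prop

namespace IsRegular

theorem integral_responseLoss_variationalTopics (h : m.IsRegular) (η : Fin K → ℝ) :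
    ∫ x, m.responseLoss η x.2 ∂m.variationalTopics = m.constantLoss - m.exponent 0 0 η := by
  rw [h.integral_variationalTopics_snd fun z => m.responseLoss η z, h.integral_responseLoss]

/-- The squares are nonnegative, so the Gaussian normalizations alone bound the loss below. -/
theorem responseLoss_bound (_h : m.IsRegular) (η : Fin K → ℝ) (z : Assignment K D N) :
    ∑ _d : Fin D, Real.log √(2 * Real.pi * m.δsq) ≤ m.responseLoss η z :=
  Finset.sum_le_sum fun d _ => le_add_of_nonneg_left (by positivity)

theorem finiteEntropy_joint_iff (h : m.IsRegular) {q : Measure (Fin K → ℝ)}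
    [IsProbabilityMeasure q] : FiniteEntropy (m.variational q) m.joint ↔
      FiniteEntropy q m.p₀ ∧ Integrable (m.exponent 0 0) q := by
  have := h.prob
  have := h.prob_variationalTopics
  have := h.finite_prior
  have : SigmaFinite m.jointTopics := SigmaFinite.withDensity_ofReal _
  rw [h.joint_eq, variational_eq, finiteEntropy_prod_withDensity_iff h.finiteEntropy_topics
    measurable_responseLoss_latent (fun x => h.responseLoss_bound x.1 x.2.2)
    fun η => h.integrable_variationalTopics_snd fun z => m.responseLoss η z]
  simp only [h.integral_responseLoss_variationalTopics]
  refine and_congr_right fun _ => ⟨fun hi => ?_, fun hi => (integrable_const _).sub hi⟩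
  exact ((integrable_const m.constantLoss).sub hi).congr
    (Filter.Eventually.of_forall fun η => by simp)

theorem Lbs_eq (h : m.IsRegular) {q : Measure (Fin K → ℝ)} [IsProbabilityMeasure q]
    (hq : FiniteEntropy q m.p₀) (hi : Integrable (m.exponent 0 0) q) :
    m.Lbs q = ((∫ η, llr q m.p₀ η ∂q - ∫ η, m.exponent 0 0 η ∂q + m.dualConstant : ℝ) : EReal) := by
  have := h.prob
  have := h.prob_variationalTopics
  have := h.finite_prior
  have : SigmaFinite m.jointTopics := SigmaFinite.withDensity_ofReal _
  have hf : m.variational q ≪ m.joint ∧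
      Integrable (llr (m.variational q) m.joint) (m.variational q) :=
    h.finiteEntropy_joint_iff.2 ⟨hq, hi⟩
  rw [Lbs, expectedLogRatio, if_pos hf, h.joint_eq,
    variational_eq, integral_llr_prod_withDensity h.finiteEntropy_topics
    measurable_responseLoss_latent (fun x => h.responseLoss_bound x.1 x.2.2)
    (fun η => h.integrable_variationalTopics_snd fun z => m.responseLoss η z) hq] <;>
  simp only [h.integral_responseLoss_variationalTopics]
  · rw [integral_sub (integrable_const _) hi, dualConstant]
    simp only [integral_const, probReal_univ, one_smul]
    congr 1
    ring
  · exact (integrable_const _).sub hi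

theorem Lbs_eq_top_or (h : m.IsRegular) (q : Measure (Fin K → ℝ)) [IsProbabilityMeasure q] :
    m.Lbs q = ⊤ ∨ FiniteEntropy q m.p₀ ∧ Integrable (m.exponent 0 0) q := by
  rw [← h.finiteEntropy_joint_iff]
  by_cases hf : FiniteEntropy (m.variational q) m.joint
  · exact Or.inr hf
  · exact Or.inl (if_neg hf)

theorem Emargin_eq (h : m.IsRegular) {q : Measure (Fin K → ℝ)} (hq : m.Admissible q) (d : Fin D) :
    Integrable (fun η => η ⬝ᵥ m.EZbar d) q ∧ m.Emargin q d = ∫ η, η ⬝ᵥ m.EZbar d ∂q := by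
  have := hq.prob
  have := h.prob_variationalTopics
  have hi := hq.integrable d
  rw [variational_eq] at hi
  rw [Emargin, variational_eq, integral_prod _ hi]
  have h1 := hi.integral_prod_left
  have e (η : Fin K → ℝ) : ∫ x, η ⬝ᵥ zbar x.2 d ∂m.variationalTopics = η ⬝ᵥ m.EZbar d := by
    rw [h.integral_variationalTopics_snd fun z => η ⬝ᵥ zbar z d, h.dotProduct_EZbar]
  simp only [e] at h1 ⊢
  exact ⟨h1, trivial⟩

/-- Jensen, as nonnegativity of the variance of each `η ⬝ᵥ zbar z d`. -/
theorem sq_dotProduct_EZbar_le (h : m.IsRegular) (η : Fin K → ℝ) :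
    ∑ d, (η ⬝ᵥ m.EZbar d) ^ 2 ≤ η ⬝ᵥ (m.EAtA *ᵥ η) := by
  have := h.prob_qz
  rw [h.dotProduct_EAtA, integral_finsetSum _ fun k _ => h.integrable_qz _]
  refine Finset.sum_le_sum fun d _ => ?_
  have h0 : 0 ≤ ∫ z, (η ⬝ᵥ zbar z d - η ⬝ᵥ m.EZbar d) ^ 2 ∂m.qz :=
    integral_nonneg fun z => sq_nonneg _
  have e : ∫ z, (η ⬝ᵥ zbar z d - η ⬝ᵥ m.EZbar d) ^ 2 ∂m.qz =
      ∫ z, (η ⬝ᵥ zbar z d) ^ 2 ∂m.qz - (η ⬝ᵥ m.EZbar d) ^ 2 := by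
    simp only [sub_sq]
    rw [integral_add (h.integrable_qz _) (h.integrable_qz _),
      integral_sub (h.integrable_qz _) (h.integrable_qz _), integral_mul_const, integral_const_mul,
      ← h.dotProduct_EZbar]
    simp
    ring
  linarith

/-- Young's inequality `b t ≤ δ² b² + t² / (4δ²)` together with Jensen spends half of the quadratic
term on the linear one. The other half remains to control second moments. -/
theorem exponent_le (h : m.IsRegular) (μ μs : Fin D → ℝ) (η : Fin K → ℝ) :
    m.exponent μ μs η ≤ m.δsq * ∑ d, (μ d - μs d + m.y d / m.δsq) ^ 2
      - η ⬝ᵥ (m.EAtA *ᵥ η) / (4 * m.δsq) := by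
  have hδ : (0 : ℝ) < m.δsq := by exact_mod_cast h.pos_δsq
  have h1 : ∑ d, (μ d - μs d + m.y d / m.δsq) * (η ⬝ᵥ m.EZbar d) ≤
      ∑ d, (m.δsq * (μ d - μs d + m.y d / m.δsq) ^ 2 + (η ⬝ᵥ m.EZbar d) ^ 2 / (4 * m.δsq)) := by
    refine Finset.sum_le_sum fun d _ => ?_
    generalize μ d - μs d + m.y d / m.δsq = b
    generalize η ⬝ᵥ m.EZbar d = t
    have : m.δsq * b ^ 2 + t ^ 2 / (4 * m.δsq) - b * t = (2 * m.δsq * b - t) ^ 2 / (4 * m.δsq) := by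
      field_simp
      ring
    have h2 : (0 : ℝ) ≤ (2 * m.δsq * b - t) ^ 2 / (4 * m.δsq) := by positivity
    linarith
  rw [Finset.sum_add_distrib, ← Finset.mul_sum, ← Finset.sum_div] at h1
  have h2 := div_le_div_of_nonneg_right (h.sq_dotProduct_EZbar_le η)
    (by positivity : (0 : ℝ) ≤ 4 * m.δsq)
  simp only [exponent, dotProduct_sum, dotProduct_smul, smul_eq_mul, smul_mulVec]
  have h3 : 1 / (2 * (m.δsq : ℝ)) * η ⬝ᵥ (m.EAtA *ᵥ η) = η ⬝ᵥ (m.EAtA *ᵥ η) / (4 * m.δsq) +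
      η ⬝ᵥ (m.EAtA *ᵥ η) / (4 * m.δsq) := by
    field_simp
    ring
  linarith

end IsRegular

end MedLDA

/-! ### The tilted prior, the Lagrangian and the dual function -/

namespace MedLDA

variable {K D N M : ℕ} {m : MedLDA K D N M}

theorem tiltedPrior_eq_tilted (μ μs : Fin D → ℝ) :
    m.tiltedPrior μ μs = m.p₀.tilted (m.exponent μ μs) := rfl

theorem measurable_secondMoment :
    Measurable fun η : Fin K → ℝ => η ⬝ᵥ (m.EAtA *ᵥ η) := by
  unfold dotProduct mulVec dotProduct
  fun_prop

/-- The affine part of the Lagrangian, with the terms collected by slack variable. -/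
theorem lagrangian_affine_part (m : MedLDA K D N M) (ξ ξs μ μs v vs E : Fin D → ℝ) :
    m.C * ∑ d, (ξ d + ξs d) - ∑ d, μ d * (m.ε + ξ d - m.y d + E d)
      - ∑ d, μs d * (m.ε + ξs d + m.y d - E d) - ∑ d, (v d * ξ d + vs d * ξs d) =
    ∑ d, ((m.C - μ d - v d) * ξ d + (m.C - μs d - vs d) * ξs d)
      + (∑ d, (μ d * (m.y d - m.ε - E d) + μs d * (E d - m.y d - m.ε))) := by
  simp only [Finset.mul_sum, ← Finset.sum_sub_distrib, ← Finset.sum_add_distrib]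
  exact Finset.sum_congr rfl fun d _ => by ring

theorem sum_slack_coeff_eq_zero {μ μs v vs : Fin D → ℝ}
    (hv : ∀ d, v d = m.C - μ d ∧ vs d = m.C - μs d) (ξ ξs : Fin D → ℝ) :
    ∑ d, ((m.C - μ d - v d) * ξ d + (m.C - μs d - vs d) * ξs d) = 0 :=
  Finset.sum_eq_zero fun d _ => by rw [(hv d).1, (hv d).2]; ring

namespace IsRegular

theorem secondMoment_nonneg (h : m.IsRegular) (η : Fin K → ℝ) : 0 ≤ η ⬝ᵥ (m.EAtA *ᵥ η) :=
  (Finset.sum_nonneg fun _ _ => sq_nonneg _).trans (h.sq_dotProduct_EZbar_le η)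

theorem exponent_le_of_secondMoment (h : m.IsRegular) (μ μs : Fin D → ℝ) (η : Fin K → ℝ) :
    m.exponent μ μs η ≤ m.δsq * ∑ d, (μ d - μs d + m.y d / m.δsq) ^ 2 := by
  refine (h.exponent_le μ μs η).trans (sub_le_self _ ?_)
  exact div_nonneg (h.secondMoment_nonneg η) (by positivity)

theorem integrable_exp_exponent (h : m.IsRegular) (μ μs : Fin D → ℝ) :
    Integrable (fun η => Real.exp (m.exponent μ μs η)) m.p₀ := by
  have := h.prob
  refine (integrable_const (Real.exp (m.δsq * ∑ d, (μ d - μs d + m.y d / m.δsq) ^ 2))).mono'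
    (measurable_exponent μ μs).exp.aestronglyMeasurable (Filter.Eventually.of_forall fun η => ?_)
  rw [Real.norm_eq_abs, Real.abs_exp]
  exact Real.exp_le_exp.2 (h.exponent_le_of_secondMoment μ μs η)

theorem Z_pos (h : m.IsRegular) (μ μs : Fin D → ℝ) : 0 < m.Z μ μs := by
  have := h.prob
  exact integral_exp_pos (h.integrable_exp_exponent μ μs)

theorem prob_tiltedPrior (h : m.IsRegular) (μ μs : Fin D → ℝ) :
    IsProbabilityMeasure (m.tiltedPrior μ μs) := by
  have := h.prob
  exact isProbabilityMeasure_tilted (h.integrable_exp_exponent μ μs)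

/-- By `exponent_le`, the weighted moment is at most `e^B · W e^{-W/(4δ²)}`, and `x e^{-x} ≤ 1`
bounds this by the constant `4δ² e^B`. -/
theorem integrable_secondMoment_tiltedPrior (h : m.IsRegular) (μ μs : Fin D → ℝ) :
    Integrable (fun η => η ⬝ᵥ (m.EAtA *ᵥ η)) (m.tiltedPrior μ μs) := by
  have := h.prob
  have hδ : (0 : ℝ) < m.δsq := by exact_mod_cast h.pos_δsq
  rw [tiltedPrior_eq_tilted, integrable_tilted_iff (h.integrable_exp_exponent μ μs)]
  refine (integrable_const (Real.exp (m.δsq * ∑ d, (μ d - μs d + m.y d / m.δsq) ^ 2)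
    * (4 * m.δsq))).mono' (by
      have h1 := measurable_exponent (m := m) μ μs
      have h2 := measurable_secondMoment (m := m)
      exact (h1.exp.mul h2).aestronglyMeasurable) (Filter.Eventually.of_forall fun η => ?_)
  have hW := h.secondMoment_nonneg η
  have hE := h.exponent_le μ μs η
  generalize η ⬝ᵥ (m.EAtA *ᵥ η) = W at hW hE ⊢
  generalize (m.δsq : ℝ) * ∑ d, (μ d - μs d + m.y d / m.δsq) ^ 2 = B at hE ⊢
  rw [smul_eq_mul, Real.norm_eq_abs, abs_of_nonneg (by positivity)]
  have h1 : Real.exp (m.exponent μ μs η) ≤ Real.exp B * Real.exp (-(W / (4 * m.δsq))) := by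
    rw [← Real.exp_add]
    exact Real.exp_le_exp.2 (by linarith)
  have h2 : W / (4 * m.δsq) ≤ Real.exp (W / (4 * m.δsq)) := by
    linarith [Real.add_one_le_exp (W / (4 * m.δsq))]
  have h3 : Real.exp (-(W / (4 * m.δsq))) * W ≤ 4 * m.δsq := by
    rw [Real.exp_neg, inv_mul_le_iff₀ (Real.exp_pos _)]
    rwa [div_le_iff₀ (by positivity)] at h2
  calc Real.exp (m.exponent μ μs η) * W
      ≤ Real.exp B * Real.exp (-(W / (4 * m.δsq))) * W := mul_le_mul_of_nonneg_right h1 hW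
    _ = Real.exp B * (Real.exp (-(W / (4 * m.δsq))) * W) := mul_assoc _ _ _
    _ ≤ _ := mul_le_mul_of_nonneg_left h3 (Real.exp_pos _).le

theorem admissible_tiltedPrior (h : m.IsRegular) (μ μs : Fin D → ℝ) :
    m.Admissible (m.tiltedPrior μ μs) := by
  have hp := h.prob_tiltedPrior μ μs
  have := h.prob_variationalTopics
  refine ⟨hp, fun d => ?_⟩
  have hm (d : Fin D) : Measurable fun x : Latent K D N => x.1 ⬝ᵥ zbar x.2.2 d := by
    have h0 : Measurable fun x : Latent K D N => (x.1, x.2.2) := by fun_prop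
    have h1 := (measurable_of_discrete_snd
      (F := fun x : (Fin K → ℝ) × Assignment K D N => x.1 ⬝ᵥ zbar x.2 d)
      fun z => measurable_dotProduct_const (zbar z d)).comp h0
    simp only [Function.comp_def] at h1
    exact h1
  have hs : Integrable (fun x : Latent K D N => ∑ d, (x.1 ⬝ᵥ zbar x.2.2 d) ^ 2)
      (m.variational (m.tiltedPrior μ μs)) := by
    rw [variational_eq]
    refine integrable_prod_of_integrable_integral (c := 0)
      (Finset.measurable_fun_sum _ fun d _ => (hm d).pow_const 2)
      (fun x => Finset.sum_nonneg fun d _ => sq_nonneg _)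
      (fun η => h.integrable_variationalTopics_snd fun z => ∑ d, (η ⬝ᵥ zbar z d) ^ 2) ?_
    refine (h.integrable_secondMoment_tiltedPrior μ μs).congr
      (Filter.Eventually.of_forall fun η => ?_)
    simp only
    rw [h.integral_variationalTopics_snd fun z => ∑ d, (η ⬝ᵥ zbar z d) ^ 2, h.dotProduct_EAtA]
  have : IsProbabilityMeasure (m.variational (m.tiltedPrior μ μs)) := by
    rw [variational_eq]
    infer_instance
  -- Square integrability gives integrability through `|t| ≤ 1 + t²`.
  refine ((integrable_const 1).add hs).mono' (hm d).aestronglyMeasurable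
    (Filter.Eventually.of_forall fun x => ?_)
  have h1 : (x.1 ⬝ᵥ zbar x.2.2 d) ^ 2 ≤ ∑ d, (x.1 ⬝ᵥ zbar x.2.2 d) ^ 2 :=
    Finset.single_le_sum (f := fun d => (x.1 ⬝ᵥ zbar x.2.2 d) ^ 2) (fun d _ => sq_nonneg _)
      (Finset.mem_univ d)
  simp only [Pi.add_apply, Real.norm_eq_abs]
  refine le_trans ?_ (add_le_add le_rfl h1)
  rw [abs_le]
  constructor <;> nlinarith [sq_nonneg (x.1 ⬝ᵥ zbar x.2.2 d - 1),
    sq_nonneg (x.1 ⬝ᵥ zbar x.2.2 d + 1)]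

theorem integrable_exponent_iff (h : m.IsRegular) {q : Measure (Fin K → ℝ)} (hq : m.Admissible q)
    (μ μs : Fin D → ℝ) : Integrable (m.exponent μ μs) q ↔ Integrable (m.exponent 0 0) q := by
  have h1 : Integrable (fun η => ∑ d, (μ d - μs d) * (η ⬝ᵥ m.EZbar d)) q :=
    integrable_finsetSum _ fun d _ => (h.Emargin_eq hq d).1.const_mul _
  have e : m.exponent μ μs =
      (fun η => ∑ d, (μ d - μs d) * (η ⬝ᵥ m.EZbar d)) + m.exponent 0 0 :=
    funext fun η => exponent_eq_add μ μs η
  rw [e]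
  exact integrable_add_iff_integrable_right h1

theorem integral_exponent (h : m.IsRegular) {q : Measure (Fin K → ℝ)} (hq : m.Admissible q)
    (μ μs : Fin D → ℝ) (hi : Integrable (m.exponent 0 0) q) :
    ∫ η, m.exponent μ μs η ∂q =
      ∑ d, (μ d - μs d) * m.Emargin q d + ∫ η, m.exponent 0 0 η ∂q := by
  simp only [exponent_eq_add μ μs]
  rw [integral_add (integrable_finsetSum _ fun d _ => (h.Emargin_eq hq d).1.const_mul _) hi,
    integral_finsetSum _ fun d _ => (h.Emargin_eq hq d).1.const_mul _]
  simp only [integral_const_mul, (h.Emargin_eq hq _).2]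

theorem integrable_exponent_tiltedPrior (h : m.IsRegular) (μ μs : Fin D → ℝ) :
    Integrable (m.exponent 0 0) (m.tiltedPrior μ μs) := by
  have hq := h.admissible_tiltedPrior μ μs
  have h1 : Integrable (fun η => ∑ d, m.y d / m.δsq * (η ⬝ᵥ m.EZbar d)) (m.tiltedPrior μ μs) :=
    integrable_finsetSum _ fun d _ => (h.Emargin_eq hq d).1.const_mul _
  refine (h1.sub ((h.integrable_secondMoment_tiltedPrior μ μs).const_mul (1 / (2 * m.δsq)))).congr
    (Filter.Eventually.of_forall fun η => ?_)
  simp [exponent, dotProduct_sum, smul_mulVec]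

theorem finiteEntropy_tiltedPrior (h : m.IsRegular) (μ μs : Fin D → ℝ) :
    FiniteEntropy (m.tiltedPrior μ μs) m.p₀ := by
  have := h.prob
  have := h.prob_tiltedPrior μ μs
  have hac : m.tiltedPrior μ μs ≪ m.p₀ := tilted_absolutelyContinuous _ _
  refine ⟨hac, ?_⟩
  have hi := (h.integrable_exponent_iff (h.admissible_tiltedPrior μ μs) μ μs).2
    (h.integrable_exponent_tiltedPrior μ μs)
  refine (hi.sub (integrable_const (Real.log (m.Z μ μs)))).congr ?_
  filter_upwards [hac.ae_le (log_rnDeriv_tilted_left_self (h.integrable_exp_exponent μ μs))]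
    with x hx
  exact hx.symm

/-- The Lagrangian on the effective domain of `L^bs`. -/
theorem lagrangian_eq (h : m.IsRegular) {q : Measure (Fin K → ℝ)} (hq : m.Admissible q)
    (he : FiniteEntropy q m.p₀) (hi : Integrable (m.exponent 0 0) q)
    (ξ ξs μ μs v vs : Fin D → ℝ) :
    m.lagrangian q ξ ξs μ μs v vs =
      ((∫ η, llr q (m.tiltedPrior μ μs) η ∂q + m.D1objective μ μs + m.dualConstant
        + ∑ d, ((m.C - μ d - v d) * ξ d + (m.C - μs d - vs d) * ξs d) : ℝ) : EReal) := by
  have := hq.prob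
  have := h.prob
  -- The Gibbs identity: changing the reference from `p₀` to the tilted prior subtracts the mean
  -- exponent and adds `log Z`, the latter cancelling against the D1 objective.
  rw [lagrangian, h.Lbs_eq he hi, ← EReal.coe_add, lagrangian_affine_part, tiltedPrior_eq_tilted,
    integral_llr_tilted_right he.1 ((h.integrable_exponent_iff hq μ μs).2 hi)
      (h.integrable_exp_exponent μ μs) he.2, h.integral_exponent hq μ μs hi, D1objective, Z]
  congr 1
  have e : ∑ d, (μ d * (m.y d - m.ε - m.Emargin q d) + μs d * (m.Emargin q d - m.y d - m.ε)) =
      ∑ d, m.y d * (μ d - μs d) - m.ε * ∑ d, (μ d + μs d)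
        - ∑ d, (μ d - μs d) * m.Emargin q d := by
    simp only [Finset.mul_sum, ← Finset.sum_sub_distrib]
    exact Finset.sum_congr rfl fun d _ => by ring
  rw [e]
  ring

theorem absolutelyContinuous_tiltedPrior (h : m.IsRegular) {q : Measure (Fin K → ℝ)}
    (he : q ≪ m.p₀) (μ μs : Fin D → ℝ) : q ≪ m.tiltedPrior μ μs :=
  he.trans (absolutelyContinuous_tilted (h.integrable_exp_exponent μ μs))

theorem toReal_klDiv_tiltedPrior (h : m.IsRegular) {q : Measure (Fin K → ℝ)}
    [IsProbabilityMeasure q] (he : q ≪ m.p₀) (μ μs : Fin D → ℝ) :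
    (InformationTheory.klDiv q (m.tiltedPrior μ μs)).toReal =
      ∫ η, llr q (m.tiltedPrior μ μs) η ∂q := by
  have := h.prob_tiltedPrior μ μs
  exact InformationTheory.toReal_klDiv_of_measure_eq (h.absolutelyContinuous_tiltedPrior he μ μs)
    (by simp)

/-- The equality case of Gibbs' inequality: relative entropy between probability measures vanishes
only when they coincide. This gives uniqueness of the optimal `q`. -/
theorem eq_tiltedPrior_of_integral_llr_nonpos (h : m.IsRegular) {q : Measure (Fin K → ℝ)}
    (hq : m.Admissible q) (he : FiniteEntropy q m.p₀) (hi : Integrable (m.exponent 0 0) q)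
    (μ μs : Fin D → ℝ) (h0 : ∫ η, llr q (m.tiltedPrior μ μs) η ∂q ≤ 0) :
    q = m.tiltedPrior μ μs := by
  have := hq.prob
  have := h.prob
  have := h.prob_tiltedPrior μ μs
  rw [← h.toReal_klDiv_tiltedPrior he.1] at h0
  have hl : Integrable (llr q (m.tiltedPrior μ μs)) q :=
    integrable_llr_tilted_right he.1 ((h.integrable_exponent_iff hq μ μs).2 hi) he.2
      (h.integrable_exp_exponent μ μs)
  have ht := InformationTheory.klDiv_ne_top (h.absolutelyContinuous_tiltedPrior he.1 μ μs) hl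
  rw [← InformationTheory.klDiv_eq_zero_iff]
  exact ((ENNReal.toReal_eq_zero_iff _).1 (le_antisymm h0 ENNReal.toReal_nonneg)).resolve_right ht

theorem integral_llr_tiltedPrior_self (h : m.IsRegular) (μ μs : Fin D → ℝ) :
    ∫ η, llr (m.tiltedPrior μ μs) (m.tiltedPrior μ μs) η ∂m.tiltedPrior μ μs = 0 := by
  have := h.prob_tiltedPrior μ μs
  rw [integral_congr_ae (llr_self _)]
  simp

theorem lagrangian_tiltedPrior (h : m.IsRegular) (ξ ξs μ μs v vs : Fin D → ℝ) :
    m.lagrangian (m.tiltedPrior μ μs) ξ ξs μ μs v vs =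
      ((m.D1objective μ μs + m.dualConstant
        + ∑ d, ((m.C - μ d - v d) * ξ d + (m.C - μs d - vs d) * ξs d) : ℝ) : EReal) := by
  rw [h.lagrangian_eq (h.admissible_tiltedPrior μ μs) (h.finiteEntropy_tiltedPrior μ μs)
    (h.integrable_exponent_tiltedPrior μ μs), h.integral_llr_tiltedPrior_self, zero_add]

theorem lagrangian_eq_top (_h : m.IsRegular) {q : Measure (Fin K → ℝ)} (hL : m.Lbs q = ⊤)
    (ξ ξs μ μs v vs : Fin D → ℝ) : m.lagrangian q ξ ξs μ μs v vs = ⊤ := by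
  rw [lagrangian, hL, EReal.top_add_coe]

theorem le_lagrangian (h : m.IsRegular) {q : Measure (Fin K → ℝ)} (hq : m.Admissible q)
    {μ μs v vs : Fin D → ℝ} (hv : ∀ d, v d = m.C - μ d ∧ vs d = m.C - μs d) (ξ ξs : Fin D → ℝ) :
    ((m.D1objective μ μs + m.dualConstant : ℝ) : EReal) ≤ m.lagrangian q ξ ξs μ μs v vs := by
  have := hq.prob
  rcases h.Lbs_eq_top_or q with hL | ⟨he, hi⟩
  · rw [h.lagrangian_eq_top hL]
    exact le_top
  · rw [h.lagrangian_eq hq he hi, sum_slack_coeff_eq_zero hv, EReal.coe_le_coe_iff,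
      ← h.toReal_klDiv_tiltedPrior he.1]
    linarith [ENNReal.toReal_nonneg (a := InformationTheory.klDiv q (m.tiltedPrior μ μs))]

theorem eq_tiltedPrior_of_lagrangian_le (h : m.IsRegular) {q : Measure (Fin K → ℝ)}
    (hq : m.Admissible q) {μ μs v vs : Fin D → ℝ}
    (hv : ∀ d, v d = m.C - μ d ∧ vs d = m.C - μs d) {ξ ξs : Fin D → ℝ}
    (hle : m.lagrangian q ξ ξs μ μs v vs ≤ ((m.D1objective μ μs + m.dualConstant : ℝ) : EReal)) :
    q = m.tiltedPrior μ μs := by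
  have := hq.prob
  rcases h.Lbs_eq_top_or q with hL | ⟨he, hi⟩
  · rw [h.lagrangian_eq_top hL, top_le_iff] at hle
    exact absurd hle (EReal.coe_ne_top _)
  · rw [h.lagrangian_eq hq he hi, sum_slack_coeff_eq_zero hv, EReal.coe_le_coe_iff] at hle
    exact h.eq_tiltedPrior_of_integral_llr_nonpos hq he hi μ μs (by linarith)

theorem dualFunction_eq (h : m.IsRegular) {μ μs v vs : Fin D → ℝ}
    (hv : ∀ d, v d = m.C - μ d ∧ vs d = m.C - μs d) :
    m.dualFunction μ μs v vs = ((m.D1objective μ μs + m.dualConstant : ℝ) : EReal) := by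
  refine le_antisymm ?_ ?_
  · refine (iInf₂_le_of_le _ (h.admissible_tiltedPrior μ μs) (iInf₂_le_of_le 0 0 ?_))
    rw [h.lagrangian_tiltedPrior, sum_slack_coeff_eq_zero hv, add_zero]
  · exact le_iInf₂ fun q hq => le_iInf₂ fun ξ ξs => h.le_lagrangian hq hv ξ ξs

theorem dualFunction_eq_bot (h : m.IsRegular) {μ μs v vs : Fin D → ℝ}
    (hv : ¬ ∀ d, v d = m.C - μ d ∧ vs d = m.C - μs d) : m.dualFunction μ μs v vs = ⊥ := by
  obtain ⟨d, hd⟩ := not_forall.1 hv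
  set a : Fin D → ℝ := fun d => m.C - μ d - v d with ha
  set b : Fin D → ℝ := fun d => m.C - μs d - vs d with hb
  have hpos : 0 < ∑ d, (a d * a d + b d * b d) := by
    refine Finset.sum_pos' (fun d _ => add_nonneg (mul_self_nonneg _) (mul_self_nonneg _))
      ⟨d, Finset.mem_univ d, ?_⟩
    by_contra hle
    have h1 : a d = 0 := by nlinarith [mul_self_nonneg (a d), mul_self_nonneg (b d)]
    have h2 : b d = 0 := by nlinarith [mul_self_nonneg (a d), mul_self_nonneg (b d)]
    exact hd ⟨by simp only [ha] at h1; linarith, by simp only [hb] at h2; linarith⟩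
  rw [EReal.eq_bot_iff_forall_lt]
  intro r
  set S := ∑ d, (a d * a d + b d * b d) with hS
  -- Moving the slacks by `t` times their own coefficients `(a, b)` changes the Lagrangian by `t S`
  -- with `S > 0`; this `t` makes its value at the tilted prior `r - 1`.
  set t := (r - 1 - (m.D1objective μ μs + m.dualConstant)) / S with ht
  refine lt_of_le_of_lt (iInf₂_le_of_le _ (h.admissible_tiltedPrior μ μs)
    (iInf₂_le_of_le (fun d => t * a d) (fun d => t * b d) le_rfl)) ?_
  rw [h.lagrangian_tiltedPrior, EReal.coe_lt_coe_iff]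
  have e : ∑ d, ((m.C - μ d - v d) * (t * a d) + (m.C - μs d - vs d) * (t * b d)) = t * S := by
    rw [hS, Finset.mul_sum]
    exact Finset.sum_congr rfl fun d _ => by simp only [ha, hb]; ring
  rw [e, ht, div_mul_cancel₀ _ hpos.ne']
  linarith

/-- Weak duality: on feasible points each nonnegative multiplier is paired with a nonnegative
constraint gap. -/
theorem lagrangian_le_objective (_h : m.IsRegular) {q : Measure (Fin K → ℝ)}
    {ξ ξs μ μs v vs : Fin D → ℝ} (hf : m.Feasible q ξ ξs)
    (hn : ∀ d, 0 ≤ μ d ∧ 0 ≤ μs d ∧ 0 ≤ v d ∧ 0 ≤ vs d) :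
    m.lagrangian q ξ ξs μ μs v vs ≤ m.objective q ξ ξs := by
  refine add_le_add le_rfl (EReal.coe_le_coe_iff.2 ?_)
  have h1 : 0 ≤ ∑ d, μ d * (m.ε + ξ d - m.y d + m.Emargin q d) :=
    Finset.sum_nonneg fun d _ => mul_nonneg (hn d).1 (by linarith [hf.upper d])
  have h2 : 0 ≤ ∑ d, μs d * (m.ε + ξs d + m.y d - m.Emargin q d) :=
    Finset.sum_nonneg fun d _ => mul_nonneg (hn d).2.1 (by linarith [hf.lower d])
  have h3 : 0 ≤ ∑ d, (v d * ξ d + vs d * ξs d) :=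
    Finset.sum_nonneg fun d _ => add_nonneg (mul_nonneg (hn d).2.2.1 (hf.slack_nonneg d))
      (mul_nonneg (hn d).2.2.2 (hf.slacks_nonneg d))
  linarith

end IsRegular

end MedLDA

/-! ### Solutions of D1 and strong duality -/

theorem HasDerivAt.nonpos_of_le_right {f : ℝ → ℝ} {f' : ℝ} (hf : HasDerivAt f f' 0)
    (hle : ∀ t, 0 < t → t ≤ 1 → f t ≤ f 0) : f' ≤ 0 := by
  refine le_of_tendsto hf.tendsto_slope_zero_right ?_
  filter_upwards [Ioc_mem_nhdsGT (zero_lt_one (α := ℝ))] with t ht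
  rw [zero_add, smul_eq_mul]
  exact mul_nonpos_of_nonneg_of_nonpos (inv_nonneg.2 ht.1.le) (sub_nonpos.2 (hle t ht.1 ht.2))

namespace MedLDA

variable {K D N M : ℕ} {m : MedLDA K D N M}

namespace IsRegular

theorem continuousOn_Z (h : m.IsRegular) :
    ContinuousOn (fun p : (Fin D → ℝ) × (Fin D → ℝ) => m.Z p.1 p.2)
      {p | m.D1feasible p.1 p.2} := by
  have := h.prob
  have hδ : (0 : ℝ) < m.δsq := by exact_mod_cast h.pos_δsq
  -- On the box `|μ_d - μ_d*| ≤ C`, so the upper bound on the exponent is uniform in the multipliers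
  -- and dominated convergence applies.
  refine continuousOn_of_dominated
    (bound := fun _ => Real.exp (m.δsq * ∑ d, (m.C + |m.y d / m.δsq|) ^ 2))
    (fun p _ => (measurable_exponent p.1 p.2).exp.aestronglyMeasurable)
    (fun p hp => Filter.Eventually.of_forall fun η => ?_) (integrable_const _)
    (Filter.Eventually.of_forall fun η => ?_)
  · rw [Real.norm_eq_abs, Real.abs_exp]
    refine Real.exp_le_exp.2 ((h.exponent_le_of_secondMoment _ _ η).trans
      (mul_le_mul_of_nonneg_left (Finset.sum_le_sum fun d _ => ?_) hδ.le))
    obtain ⟨⟨h1, h2⟩, h3, h4⟩ := hp d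
    refine sq_le_sq' ?_ ?_
    · linarith [neg_abs_le (m.y d / m.δsq)]
    · linarith [le_abs_self (m.y d / m.δsq)]
  · refine Continuous.continuousOn (Real.continuous_exp.comp ?_)
    simp only [exponent, dotProduct_sum, dotProduct_smul, smul_eq_mul]
    fun_prop

theorem exists_solvesD1 (h : m.IsRegular) : ∃ μ μs, m.SolvesD1 μ μs := by
  have hcpt : IsCompact {p : (Fin D → ℝ) × (Fin D → ℝ) | m.D1feasible p.1 p.2} := by
    have e : {p : (Fin D → ℝ) × (Fin D → ℝ) | m.D1feasible p.1 p.2} =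
        Set.Icc (fun _ => 0) (fun _ => m.C) ×ˢ Set.Icc (fun _ => 0) (fun _ => m.C) := by
      ext p
      simp only [D1feasible, Set.mem_Icc, Set.mem_prod, Pi.le_def, ← forall_and]
      exact forall_congr' fun d => by tauto
    rw [e]
    exact isCompact_Icc.prod isCompact_Icc
  have hne : {p : (Fin D → ℝ) × (Fin D → ℝ) | m.D1feasible p.1 p.2}.Nonempty :=
    ⟨(0, 0), fun d => by simp [h.pos_C.le]⟩
  have hcont : ContinuousOn (fun p : (Fin D → ℝ) × (Fin D → ℝ) => m.D1objective p.1 p.2)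
      {p | m.D1feasible p.1 p.2} := by
    unfold D1objective
    have h1 := (h.continuousOn_Z.log fun p _ => (h.Z_pos p.1 p.2).ne').neg
    refine (h1.sub ?_).add ?_ <;> exact Continuous.continuousOn (by fun_prop)
  obtain ⟨p, hp, hmax⟩ := hcpt.exists_isMaxOn hne hcont
  have hmax' := isMaxOn_iff.1 hmax
  exact ⟨p.1, p.2, hp, fun μ' μs' h' => by simpa only using hmax' (μ', μs') h'⟩

/-- Along a line of multipliers the exponent changes by `t` times a fixed statistic, so `Z` is its
moment generating function under the tilted prior. Differentiating `log Z` thus yields expected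
margins. -/
theorem Z_add_smul (h : m.IsRegular) (μ μs a b : Fin D → ℝ) (t : ℝ) :
    m.Z (μ + t • a) (μs + t • b) = m.Z μ μs *
      mgf (fun η => ∑ d, (a d - b d) * (η ⬝ᵥ m.EZbar d)) (m.tiltedPrior μ μs) t := by
  have hexp (η : Fin K → ℝ) : m.exponent (μ + t • a) (μs + t • b) η =
      (m.exponent μ μs + fun η => t * ∑ d, (a d - b d) * (η ⬝ᵥ m.EZbar d)) η := by
    rw [Pi.add_apply, exponent_eq_add, exponent_eq_add μ μs, Finset.mul_sum, add_right_comm,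
      ← Finset.sum_add_distrib]
    congr 1
    refine Finset.sum_congr rfl fun d _ => ?_
    simp only [Pi.add_apply, Pi.smul_apply, smul_eq_mul]
    ring
  rw [mgf, tiltedPrior_eq_tilted, integral_exp_tilted, Z]
  simp only [hexp]
  rw [← Z, mul_div_cancel₀ _ (h.Z_pos μ μs).ne']

theorem integrableExpSet_tiltedPrior (h : m.IsRegular) (μ μs a b : Fin D → ℝ) :
    integrableExpSet (fun η => ∑ d, (a d - b d) * (η ⬝ᵥ m.EZbar d)) (m.tiltedPrior μ μs) =
      Set.univ := by
  refine Set.eq_univ_of_forall fun t => ?_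
  -- `mgf` takes the value `0` where the exponential is not integrable, which would contradict `Z >
  -- 0`.
  by_contra hn
  have h0 := h.Z_add_smul μ μs a b t
  rw [mgf_undef hn, mul_zero] at h0
  exact (h.Z_pos _ _).ne' h0

theorem hasDerivAt_D1objective (h : m.IsRegular) (μ μs a b : Fin D → ℝ) :
    HasDerivAt (fun t : ℝ => m.D1objective (μ + t • a) (μs + t • b))
      (∑ d, (a d * (m.y d - m.ε - m.Emargin (m.tiltedPrior μ μs) d)
        + b d * (m.Emargin (m.tiltedPrior μ μs) d - m.y d - m.ε))) 0 := by
  have hq := h.admissible_tiltedPrior μ μs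
  have := hq.prob
  have hZ := h.Z_pos μ μs
  set X : (Fin K → ℝ) → ℝ := fun η => ∑ d, (a d - b d) * (η ⬝ᵥ m.EZbar d) with hX
  have hEX : ∫ η, X η ∂m.tiltedPrior μ μs =
      ∑ d, (a d - b d) * m.Emargin (m.tiltedPrior μ μs) d := by
    rw [integral_finsetSum _ fun d _ => (h.Emargin_eq hq d).1.const_mul _]
    simp only [integral_const_mul, (h.Emargin_eq hq _).2]
  have hmgf : HasDerivAt (mgf X (m.tiltedPrior μ μs)) (∫ η, X η ∂m.tiltedPrior μ μs) 0 := by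
    have h1 := hasDerivAt_mgf (X := X) (μ := m.tiltedPrior μ μs) (t := 0)
      (by rw [h.integrableExpSet_tiltedPrior μ μs a b]; simp)
    simpa using h1
  have hlog : HasDerivAt (fun t : ℝ => Real.log (m.Z (μ + t • a) (μs + t • b)))
      (∫ η, X η ∂m.tiltedPrior μ μs) 0 := by
    simp only [h.Z_add_smul]
    have h2 := (hmgf.const_mul (m.Z μ μs)).log (by simp [hZ.ne'])
    rw [mgf_zero, mul_one, mul_div_cancel_left₀ _ hZ.ne'] at h2
    exact h2
  have hlin1 : HasDerivAt (fun t : ℝ => m.ε * ∑ d, ((μ + t • a) d + (μs + t • b) d))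
      (m.ε * ∑ d, (a d + b d)) 0 := by
    refine (HasDerivAt.fun_sum fun d _ => ?_).const_mul m.ε
    simp only [Pi.add_apply, Pi.smul_apply, smul_eq_mul]
    exact ((hasDerivAt_mul_const (a d)).const_add (μ d)).add
      ((hasDerivAt_mul_const (b d)).const_add (μs d))
  have hlin2 : HasDerivAt (fun t : ℝ => ∑ d, m.y d * ((μ + t • a) d - (μs + t • b) d))
      (∑ d, m.y d * (a d - b d)) 0 := by
    refine HasDerivAt.fun_sum fun d _ => ?_
    simp only [Pi.add_apply, Pi.smul_apply, smul_eq_mul]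
    exact (((hasDerivAt_mul_const (a d)).const_add (μ d)).sub
      ((hasDerivAt_mul_const (b d)).const_add (μs d))).const_mul (m.y d)
  have hall := (hlog.neg.sub hlin1).add hlin2
  rw [hEX] at hall
  refine hall.congr_deriv ?_
  simp only [Finset.mul_sum, ← Finset.sum_neg_distrib, ← Finset.sum_sub_distrib,
    ← Finset.sum_add_distrib]
  exact Finset.sum_congr rfl fun d _ => by ring

/-- The first-order optimality condition of D1. -/
theorem sum_max_le_of_solvesD1 (h : m.IsRegular) {μ μs : Fin D → ℝ} (hs : m.SolvesD1 μ μs) :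
    m.C * ∑ d, (max (m.y d - m.ε - m.Emargin (m.tiltedPrior μ μs) d) 0
        + max (m.Emargin (m.tiltedPrior μ μs) d - m.y d - m.ε) 0) ≤
      ∑ d, (μ d * (m.y d - m.ε - m.Emargin (m.tiltedPrior μ μs) d)
        + μs d * (m.Emargin (m.tiltedPrior μ μs) d - m.y d - m.ε)) := by
  set r : Fin D → ℝ := fun d => m.y d - m.ε - m.Emargin (m.tiltedPrior μ μs) d
  set s : Fin D → ℝ := fun d => m.Emargin (m.tiltedPrior μ μs) d - m.y d - m.ε
  -- `u x` is a maximizer of `c * x` over `c ∈ [0, C]`, with maximum `C * max x 0`.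
  set u : ℝ → ℝ := fun x => if 0 < x then m.C else 0 with hu
  have hu0 (x : ℝ) : 0 ≤ u x ∧ u x ≤ m.C := by
    simp only [hu]
    split_ifs <;> simp [h.pos_C.le]
  have hux (x : ℝ) : u x * x = m.C * max x 0 := by
    simp only [hu]
    split_ifs with hx
    · rw [max_eq_left hx.le]
    · rw [max_eq_right (not_lt.1 hx), zero_mul, mul_zero]
  -- Differentiate from `(μ, μ*)` towards this vertex; the segment stays in the box by convexity.
  have hd := (h.hasDerivAt_D1objective μ μs (fun d => u (r d) - μ d)
    fun d => u (s d) - μs d).nonpos_of_le_right fun t ht ht1 => by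
      simp only [zero_smul, add_zero]
      refine hs.2 _ _ fun d => ?_
      obtain ⟨⟨h1, h2⟩, h3, h4⟩ := hs.1 d
      have h5 := hu0 (r d)
      have h6 := hu0 (s d)
      simp only [Pi.add_apply, Pi.smul_apply, smul_eq_mul, Set.mem_Icc]
      refine ⟨⟨?_, ?_⟩, ?_, ?_⟩ <;> nlinarith
  have e : ∑ d, ((u (r d) - μ d) * r d + (u (s d) - μs d) * s d) =
      m.C * ∑ d, (max (r d) 0 + max (s d) 0) - ∑ d, (μ d * r d + μs d * s d) := by
    rw [Finset.mul_sum, ← Finset.sum_sub_distrib]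
    exact Finset.sum_congr rfl fun d _ => by rw [mul_add, ← hux, ← hux]; ring
  have hd' : ∑ d, ((u (r d) - μ d) * r d + (u (s d) - μs d) * s d) ≤ 0 := hd
  linarith

theorem objective_tiltedPrior_le (h : m.IsRegular) {μ μs : Fin D → ℝ} (hs : m.SolvesD1 μ μs) :
    ∃ ξ ξs, m.Feasible (m.tiltedPrior μ μs) ξ ξs ∧ m.objective (m.tiltedPrior μ μs) ξ ξs ≤
      ((m.D1objective μ μs + m.dualConstant : ℝ) : EReal) := by
  set q := m.tiltedPrior μ μs with hq
  -- For this `q` these are the smallest slacks that satisfy the constraints.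
  refine ⟨fun d => max (m.y d - m.ε - m.Emargin q d) 0,
    fun d => max (m.Emargin q d - m.y d - m.ε) 0, ⟨h.admissible_tiltedPrior μ μs, fun d => ?_,
      fun d => ?_, fun d => le_max_right _ _, fun d => le_max_right _ _⟩, ?_⟩
  · linarith [le_max_left (m.y d - m.ε - m.Emargin q d) 0]
  · linarith [le_max_left (m.Emargin q d - m.y d - m.ε) 0]
  · have hv : ∀ d, (fun d => m.C - μ d) d = m.C - μ d ∧ (fun d => m.C - μs d) d = m.C - μs d :=
      fun d => ⟨rfl, rfl⟩
    -- With vanishing slack coefficients the Lagrangian does not depend on the slacks, so zero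
    -- slacks suffice to express the dual value; what remains is the first-order inequality.
    have hL := h.lagrangian_tiltedPrior 0 0 μ μs (fun d => m.C - μ d) fun d => m.C - μs d
    rw [sum_slack_coeff_eq_zero hv, add_zero] at hL
    rw [← hL, lagrangian, lagrangian_affine_part, sum_slack_coeff_eq_zero hv, zero_add]
    exact add_le_add le_rfl (EReal.coe_le_coe_iff.2 (h.sum_max_le_of_solvesD1 hs))

theorem le_objective (h : m.IsRegular) {μ μs : Fin D → ℝ} (hf : m.D1feasible μ μs)
    {q : Measure (Fin K → ℝ)} {ξ ξs : Fin D → ℝ} (hq : m.Feasible q ξ ξs) :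
    ((m.D1objective μ μs + m.dualConstant : ℝ) : EReal) ≤ m.objective q ξ ξs :=
  (h.le_lagrangian (v := fun d => m.C - μ d) (vs := fun d => m.C - μs d) hq.admissible
    (fun _ => ⟨rfl, rfl⟩) ξ ξs).trans (h.lagrangian_le_objective hq fun d =>
      ⟨(hf d).1.1, (hf d).2.1, sub_nonneg.2 (hf d).1.2, sub_nonneg.2 (hf d).2.2⟩)

theorem primalValue_eq (h : m.IsRegular) {μ μs : Fin D → ℝ} (hs : m.SolvesD1 μ μs) :
    m.primalValue = ((m.D1objective μ μs + m.dualConstant : ℝ) : EReal) := by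
  refine le_antisymm ?_ ?_
  · obtain ⟨ξ, ξs, hf, hle⟩ := h.objective_tiltedPrior_le hs
    exact (iInf₂_le_of_le _ ξ (iInf₂_le_of_le ξs hf le_rfl)).trans hle
  · exact le_iInf₂ fun q ξ => le_iInf₂ fun ξs hf => h.le_objective hs.1 hf

theorem isLagrangeMultiplier_iff (h : m.IsRegular) (μ μs v vs : Fin D → ℝ) :
    m.IsLagrangeMultiplier μ μs v vs ↔
      m.SolvesD1 μ μs ∧ ∀ d, v d = m.C - μ d ∧ vs d = m.C - μs d := by
  constructor
  · rintro ⟨hn, hdual⟩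
    obtain ⟨ν, νs, hν⟩ := h.exists_solvesD1
    rw [h.primalValue_eq hν] at hdual
    -- The primal value is finite, which excludes a dual function equal to `⊥`.
    have hv : ∀ d, v d = m.C - μ d ∧ vs d = m.C - μs d := by
      by_contra hv
      rw [h.dualFunction_eq_bot hv] at hdual
      exact EReal.bot_ne_coe _ hdual
    rw [h.dualFunction_eq hv, EReal.coe_eq_coe_iff, add_left_inj] at hdual
    refine ⟨⟨fun d => ?_, fun μ' μs' h' => hdual ▸ hν.2 μ' μs' h'⟩, hv⟩
    obtain ⟨h1, h2, h3, h4⟩ := hn d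
    -- The upper bounds `μ_d, μ_d* ≤ C` are the nonnegativity of `v_d, v_d*`.
    exact ⟨⟨h1, by linarith [(hv d).1]⟩, h2, by linarith [(hv d).2]⟩
  · rintro ⟨hs, hv⟩
    refine ⟨fun d => ?_, by rw [h.dualFunction_eq hv, h.primalValue_eq hs]⟩
    obtain ⟨⟨h1, h2⟩, h3, h4⟩ := hs.1 d
    exact ⟨h1, h3, by linarith [(hv d).1], by linarith [(hv d).2]⟩

theorem exists_isOptimal_tiltedPrior (h : m.IsRegular) {μ μs : Fin D → ℝ}
    (hs : m.SolvesD1 μ μs) : ∃ ξ ξs, m.IsOptimal (m.tiltedPrior μ μs) ξ ξs := by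
  obtain ⟨ξ, ξs, hf, hle⟩ := h.objective_tiltedPrior_le hs
  exact ⟨ξ, ξs, hf, fun q' ξ' ξs' hf' => hle.trans (h.le_objective hs.1 hf')⟩

/-- An optimal point has Lagrangian at most its objective, hence at most the dual value, and only
the tilted prior attains that. -/
theorem eq_tiltedPrior_of_isOptimal (h : m.IsRegular) {μ μs : Fin D → ℝ}
    (hs : m.SolvesD1 μ μs) {q : Measure (Fin K → ℝ)} {ξ ξs : Fin D → ℝ}
    (ho : m.IsOptimal q ξ ξs) : q = m.tiltedPrior μ μs := by
  obtain ⟨ξ', ξs', hf, hle⟩ := h.objective_tiltedPrior_le hs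
  refine h.eq_tiltedPrior_of_lagrangian_le (v := fun d => m.C - μ d) (vs := fun d => m.C - μs d)
    (ξ := ξ) (ξs := ξs) ho.1.admissible (fun _ => ⟨rfl, rfl⟩) ?_
  exact (h.lagrangian_le_objective ho.1 fun d => ⟨(hs.1 d).1.1, (hs.1 d).2.1,
    sub_nonneg.2 (hs.1 d).1.2, sub_nonneg.2 (hs.1 d).2.2⟩).trans ((ho.2 _ _ _ hf).trans hle)

end IsRegular

end MedLDA

theorem theorem1 {K D N M : ℕ} (m : MedLDA K D N M)
    (hN : 0 < N) (hC : 0 < m.C) (hδ : 0 < m.δsq)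
    (hp₀ : IsProbabilityMeasure m.p₀)
    (hα : ∀ k, 0 < m.α k)
    (hβ : ∀ k, (∀ v, 0 ≤ m.β k v) ∧ ∑ v, m.β k v = 1)
    (hγ : ∀ d k, 0 < m.γ d k)
    (hφ : ∀ d n, (∀ k, 0 ≤ m.φ d n k) ∧ ∑ k, m.φ d n k = 1)
    -- the fixed variational distribution charges no topic that cannot generate the observed word
    (hφβ : ∀ d n k, m.φ d n k ≠ 0 → m.β k (m.w d n) ≠ 0) :
    -- the expectations of the topic assignments, in terms of `φ`
    (∀ d, m.EZbar d = (1 / (N : ℝ)) • ∑ n, m.φ d n) ∧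
    m.EAtA = ∑ d, m.EZbarZbarT d ∧
    (∀ d, m.EZbarZbarT d = (1 / (N : ℝ) ^ 2) •
      ((∑ n, ∑ m' ∈ Finset.univ.erase n, vecMulVec (m.φ d n) (m.φ d m'))
        + ∑ n, Matrix.diagonal (m.φ d n))) ∧
    -- the normalization constant is finite and positive
    (∀ μ μs, Integrable (fun η => Real.exp (m.exponent μ μs η)) m.p₀ ∧ 0 < m.Z μ μs) ∧
    -- the dual problem of the primal problem is D1, up to an additive constant
    (∃ c : ℝ, ∀ μ μs v vs : Fin D → ℝ,
      ((∀ d, v d = m.C - μ d ∧ vs d = m.C - μs d) →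
        m.dualFunction μ μs v vs = ((m.D1objective μ μs + c : ℝ) : EReal)) ∧
      (¬ (∀ d, v d = m.C - μ d ∧ vs d = m.C - μs d) → m.dualFunction μ μs v vs = ⊥)) ∧
    -- D1 has a solution, and its solutions are exactly the Lagrange multipliers
    (∃ μ μs, m.SolvesD1 μ μs) ∧
    (∀ μ μs v vs : Fin D → ℝ, m.IsLagrangeMultiplier μ μs v vs ↔
      m.SolvesD1 μ μs ∧ ∀ d, v d = m.C - μ d ∧ vs d = m.C - μs d) ∧
    -- for every solution of D1 the tilted prior is the unique optimal `q(η)`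
    (∀ μ μs, m.SolvesD1 μ μs →
      (∃ ξ ξs, m.IsOptimal (m.tiltedPrior μ μs) ξ ξs) ∧
      (∀ q ξ ξs, m.IsOptimal q ξ ξs → q = m.tiltedPrior μ μs)) := by

  have h : m.IsRegular := ⟨hC, hδ, hp₀, hα, fun k => (hβ k).1, hγ, fun d n => (hφ d n).1,
    fun d n => (hφ d n).2, hφβ⟩
  exact ⟨h.EZbar_eq, h.EAtA_eq, h.EZbarZbarT_eq,
    fun μ μs => ⟨h.integrable_exp_exponent μ μs, h.Z_pos μ μs⟩,
    ⟨m.dualConstant, fun μ μs v vs => ⟨h.dualFunction_eq, h.dualFunction_eq_bot⟩⟩,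
    h.exists_solvesD1, h.isLagrangeMultiplier_iff,
    fun μ μs hs => ⟨h.exists_isOptimal_tiltedPrior hs,
      fun q ξ ξs => h.eq_tiltedPrior_of_isOptimal hs⟩⟩
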